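/- Let $(\mathcal M,\varphi,\xi,\eta,g)$ be a smooth Riemannian $\Pi$-manifold of dimension $2n+1$: $g$ is a Riemannian metric, $\varphi$ a $(1,1)$-tensor field, $\xi$ a vector field and $\eta$ a 1-form on $\mathcal M$, all smooth, such that $$\varphi\xi=0,\quad \varphi^2=I-\eta\otimes\xi,\quad \eta\circ\varphi=0,\quad \eta(\xi)=1,\quad \operatorname{tr}\varphi=0,\quad g(\varphi x,\varphi y)=g(x,y)-\eta(x)\eta(y).$$ Let $\tilde g(x,y)=g(x,\varphi y)+\eta(x)\eta(y)$ be the associated (indefinite) metric, $\nabla$ the Levi-Civita connection of $g$, $R(x,y)z=\nabla_x\nabla_yz-\nabla_y\nabla_xz-\nabla_{[x,y]}z$ its curvature, $\rho(y,z)=\operatorname{tr}\bigl(x\mapsto R(x,y)z\bigr)$ its Ricci tensor, and let $\tau$ and $\tilde\tau$ be the scalar curvatures of $g$ and of $\tilde g$ (the latter computed from the Levi-Civita connection of $\tilde g$). Suppose that the manifold is para-Sasaki-like, i.e. $$(\nabla_x\varphi)y=-g(x,y)\xi-\eta(y)x+2\eta(x)\eta(y)\xi ,$$ and that it admits a para-Ricci-like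 soliton with potential an arbitrary smooth vector field $v$ and real constants $(\lambda,\mu,\nu)$, i.e. $$\rho=-\tfrac12\mathcal L_vg-\lambda g-\mu\tilde g-\nu\,\eta\otimes\eta .$$ Then $$(\mathcal L_v\rho)(x,\xi)=0\ \text{ for every vector field } x,\qquad \tau=-2n,\qquad \tilde\tau=\mathrm{const}.$$ -/

import Mathlib

open scoped Manifold ContDiff Bundle

noncomputable section

namespace PiGeometry

/-- Smooth vector fields. -/
def IsSmoothField {E : Type*} [NormedAddCommGroup E] [NormedSpace ℝ E]
    {M : Type*} [TopologicalSpace M] [ChartedSpace E M] [IsManifold 𝓘(ℝ, E) ∞ M]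
    (X : Π p : M, TangentSpace 𝓘(ℝ, E) p) : Prop :=
  ContMDiff 𝓘(ℝ, E) 𝓘(ℝ, E).tangent ∞ (fun p ↦ (⟨p, X p⟩ : TangentBundle 𝓘(ℝ, E) M))

/-- A smooth affine connection `∇` on `M` (with `∇ Y p x` standing for `(∇_x Y)(p)`) is the
Levi-Civita connection of the (possibly indefinite) metric `h` if it is torsion free and satisfies
`x (h(Y, Z)) = h(∇_x Y, Z) + h(Y, ∇_x Z)`. -/
structure IsLeviCivita {E : Type*} [NormedAddCommGroup E] [NormedSpace ℝ E]
    [FiniteDimensional ℝ E]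
    {M : Type*} [TopologicalSpace M] [ChartedSpace E M] [IsManifold 𝓘(ℝ, E) ∞ M]
    (h : Π p : M, TangentSpace 𝓘(ℝ, E) p → TangentSpace 𝓘(ℝ, E) p → ℝ)
    (nabla : CovariantDerivative 𝓘(ℝ, E) E (fun p : M ↦ TangentSpace 𝓘(ℝ, E) p)) : Prop where
  smooth : CovariantDerivative.ContMDiffCovariantDerivative nabla ∞
  torsion_free : nabla.torsion = 0
  metric : ∀ (p : M) (Y Z : Π q : M, TangentSpace 𝓘(ℝ, E) q),
    MDifferentiableAt 𝓘(ℝ, E) 𝓘(ℝ, E).tangent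
      (fun q ↦ (⟨q, Y q⟩ : TangentBundle 𝓘(ℝ, E) M)) p →
    MDifferentiableAt 𝓘(ℝ, E) 𝓘(ℝ, E).tangent
      (fun q ↦ (⟨q, Z q⟩ : TangentBundle 𝓘(ℝ, E) M)) p →
    ∀ x : TangentSpace 𝓘(ℝ, E) p,
      mvfderiv 𝓘(ℝ, E) (fun q ↦ h q (Y q) (Z q)) p x
        = h p (nabla Y p x) (Z p) + h p (Y p) (nabla Z p x)

/-- `R(X, Y)Z = ∇_X ∇_Y Z - ∇_Y ∇_X Z - ∇_[X, Y] Z`, for vector fields. -/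
def curvature {E : Type*} [NormedAddCommGroup E] [NormedSpace ℝ E]
    {M : Type*} [TopologicalSpace M] [ChartedSpace E M] [IsManifold 𝓘(ℝ, E) ∞ M]
    (nabla : CovariantDerivative 𝓘(ℝ, E) E (fun p : M ↦ TangentSpace 𝓘(ℝ, E) p))
    (X Y Z : Π p : M, TangentSpace 𝓘(ℝ, E) p) (p : M) : TangentSpace 𝓘(ℝ, E) p :=
  nabla (fun q ↦ nabla Z q (Y q)) p (X p) - nabla (fun q ↦ nabla Z q (X q)) p (Y p)
    - nabla Z p (VectorField.mlieBracket 𝓘(ℝ, E) X Y p)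

/-- The curvature tensor at `p`: tangent vectors are extended to vector fields that are smooth
near `p`, and the value does not depend on the extensions. -/
def curvatureAt {E : Type*} [NormedAddCommGroup E] [NormedSpace ℝ E]
    {M : Type*} [TopologicalSpace M] [ChartedSpace E M] [IsManifold 𝓘(ℝ, E) ∞ M]
    (nabla : CovariantDerivative 𝓘(ℝ, E) E (fun p : M ↦ TangentSpace 𝓘(ℝ, E) p))
    (p : M) (x y z : TangentSpace 𝓘(ℝ, E) p) : TangentSpace 𝓘(ℝ, E) p :=
  curvature nabla (FiberBundle.extend E x) (FiberBundle.extend E y) (FiberBundle.extend E z) p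

/-- A basis of the tangent space at `p`, used to write traces. -/
def tangentBasis {E : Type*} [NormedAddCommGroup E] [NormedSpace ℝ E] [FiniteDimensional ℝ E]
    {M : Type*} [TopologicalSpace M] [ChartedSpace E M] (p : M) :
    Module.Basis (Fin (Module.finrank ℝ E)) ℝ (TangentSpace 𝓘(ℝ, E) p) :=
  Module.finBasis ℝ E

/-- The Ricci tensor `ρ(y, z) = trace (x ↦ R(x, y)z)`. -/
def ricci {E : Type*} [NormedAddCommGroup E] [NormedSpace ℝ E] [FiniteDimensional ℝ E]
    {M : Type*} [TopologicalSpace M] [ChartedSpace E M] [IsManifold 𝓘(ℝ, E) ∞ M]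
    (nabla : CovariantDerivative 𝓘(ℝ, E) E (fun p : M ↦ TangentSpace 𝓘(ℝ, E) p))
    (p : M) (y z : TangentSpace 𝓘(ℝ, E) p) : ℝ :=
  ∑ i, (tangentBasis p).repr (curvatureAt nabla p (tangentBasis p i) y z) i

/-- The scalar curvature `h^{ij} ρ_{ij}` of a metric `h` with Levi-Civita connection `∇`, where
`(h^{ij})` is the inverse of the matrix `(h_{ij})` of `h` in a basis of the tangent space. -/
def scalarCurvature {E : Type*} [NormedAddCommGroup E] [NormedSpace ℝ E]
    [FiniteDimensional ℝ E]
    {M : Type*} [TopologicalSpace M] [ChartedSpace E M] [IsManifold 𝓘(ℝ, E) ∞ M]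
    (h : Π p : M, TangentSpace 𝓘(ℝ, E) p → TangentSpace 𝓘(ℝ, E) p → ℝ)
    (nabla : CovariantDerivative 𝓘(ℝ, E) E (fun p : M ↦ TangentSpace 𝓘(ℝ, E) p))
    (p : M) : ℝ :=
  ∑ i, ∑ j, (Matrix.of fun k l ↦ h p (tangentBasis p k) (tangentBasis p l))⁻¹ i j
    * ricci nabla p (tangentBasis p i) (tangentBasis p j)

/-- The Lie derivative of a `(0,2)`-tensor field `B`, evaluated on vector fields:
`(L_v B)(X, Y) = v (B(X, Y)) - B([v, X], Y) - B(X, [v, Y])`. -/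
def lieDeriv {E : Type*} [NormedAddCommGroup E] [NormedSpace ℝ E]
    {M : Type*} [TopologicalSpace M] [ChartedSpace E M] [IsManifold 𝓘(ℝ, E) ∞ M]
    (v : Π p : M, TangentSpace 𝓘(ℝ, E) p)
    (B : Π p : M, TangentSpace 𝓘(ℝ, E) p → TangentSpace 𝓘(ℝ, E) p → ℝ)
    (X Y : Π p : M, TangentSpace 𝓘(ℝ, E) p) (p : M) : ℝ :=
  mvfderiv 𝓘(ℝ, E) (fun q ↦ B q (X q) (Y q)) p (v p)
    - B p (VectorField.mlieBracket 𝓘(ℝ, E) v X p) (Y p)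
    - B p (X p) (VectorField.mlieBracket 𝓘(ℝ, E) v Y p)

/-- A Riemannian `Π`-structure `(φ, ξ, η, g)` on `M`, all of whose tensor fields are smooth. -/
structure RiemannianPiStructure (E : Type*) [NormedAddCommGroup E] [NormedSpace ℝ E]
    (M : Type*) [TopologicalSpace M] [ChartedSpace E M] [IsManifold 𝓘(ℝ, E) ∞ M] where
  g : Bundle.ContMDiffRiemannianMetric 𝓘(ℝ, E) ∞ E (fun p : M ↦ TangentSpace 𝓘(ℝ, E) p)
  φ : Π p : M, TangentSpace 𝓘(ℝ, E) p →L[ℝ] TangentSpace 𝓘(ℝ, E) p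
  ξ : Π p : M, TangentSpace 𝓘(ℝ, E) p
  η : Π p : M, TangentSpace 𝓘(ℝ, E) p →L[ℝ] ℝ
  φ_smooth : ContMDiff 𝓘(ℝ, E) (𝓘(ℝ, E).prod 𝓘(ℝ, E →L[ℝ] E)) ∞
    (fun p ↦ Bundle.TotalSpace.mk' (E →L[ℝ] E)
      (E := fun p : M ↦ TangentSpace 𝓘(ℝ, E) p →L[ℝ] TangentSpace 𝓘(ℝ, E) p) p (φ p))
  ξ_smooth : IsSmoothField ξ
  η_smooth : ContMDiff 𝓘(ℝ, E) (𝓘(ℝ, E).prod 𝓘(ℝ, E →L[ℝ] ℝ)) ∞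
    (fun p ↦ Bundle.TotalSpace.mk' (E →L[ℝ] ℝ)
      (E := fun p : M ↦ TangentSpace 𝓘(ℝ, E) p →L[ℝ] Bundle.Trivial M ℝ p) p (η p))
  φ_ξ : ∀ p, φ p (ξ p) = 0
  φ_sq : ∀ p x, φ p (φ p x) = x - η p x • ξ p
  η_φ : ∀ p x, η p (φ p x) = 0
  η_ξ : ∀ p, η p (ξ p) = 1
  trace_φ : ∀ p, LinearMap.trace ℝ (TangentSpace 𝓘(ℝ, E) p) (φ p).toLinearMap = 0
  g_φ : ∀ p x y, g.inner p (φ p x) (φ p y) = g.inner p x y - η p x * η p y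

namespace RiemannianPiStructure

variable {E : Type*} [NormedAddCommGroup E] [NormedSpace ℝ E]
  {M : Type*} [TopologicalSpace M] [ChartedSpace E M] [IsManifold 𝓘(ℝ, E) ∞ M]

/-- The metric `g`, as a function of two tangent vectors. -/
def metric (S : RiemannianPiStructure E M) (p : M) (x y : TangentSpace 𝓘(ℝ, E) p) : ℝ :=
  S.g.inner p x y

/-- The associated metric `g̃(x, y) = g(x, φ y) + η(x) η(y)`. -/
def assocMetric (S : RiemannianPiStructure E M) (p : M) (x y : TangentSpace 𝓘(ℝ, E) p) : ℝ :=
  S.metric p x (S.φ p y) + S.η p x * S.η p y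

/-- The para-Sasaki-like condition, `∇` being the Levi-Civita connection of `g`:
`(∇_x φ) y = -g(x, y) ξ - η(y) x + 2 η(x) η(y) ξ`, where
`(∇_x φ) Y = ∇_x (φ Y) - φ (∇_x Y)`. -/
def IsParaSasakiLike (S : RiemannianPiStructure E M)
    (nabla : CovariantDerivative 𝓘(ℝ, E) E (fun p : M ↦ TangentSpace 𝓘(ℝ, E) p)) : Prop :=
  ∀ Y : Π p : M, TangentSpace 𝓘(ℝ, E) p, IsSmoothField Y →
    ∀ (p : M) (x : TangentSpace 𝓘(ℝ, E) p),
      nabla (fun q ↦ S.φ q (Y q)) p x - S.φ p (nabla Y p x)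
        = -(S.metric p x (Y p) • S.ξ p) - S.η p (Y p) • x
          + (2 * S.η p x * S.η p (Y p)) • S.ξ p

/-- The para-Ricci-like soliton equation `ρ = -(1/2) L_v g - λ g - μ g̃ - ν η ⊗ η` with potential
`v` and constants `(lam, mu, nu)`, `∇` being the Levi-Civita connection of `g`. -/
def IsParaRicciLikeSoliton [FiniteDimensional ℝ E] (S : RiemannianPiStructure E M)
    (nabla : CovariantDerivative 𝓘(ℝ, E) E (fun p : M ↦ TangentSpace 𝓘(ℝ, E) p))
    (v : Π p : M, TangentSpace 𝓘(ℝ, E) p) (lam mu nu : ℝ) : Prop :=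
  ∀ X Y : Π p : M, TangentSpace 𝓘(ℝ, E) p, IsSmoothField X → IsSmoothField Y → ∀ p : M,
    ricci nabla p (X p) (Y p)
      = -(1 / 2) * lieDeriv v S.metric X Y p - lam * S.metric p (X p) (Y p)
        - mu * S.assocMetric p (X p) (Y p) - nu * (S.η p (X p) * S.η p (Y p))

end RiemannianPiStructure

end PiGeometry

end

/-! Write f = η(v), c = 2n - λ - μ - ν, and L for Lie derivatives. A para-Sasaki-like structure has
∇ξ = φ. Hence η is closed, ξ preserves φ, η and ρ, and L_ξ g = 2g(·, φ·); moreover ρ(x, ξ) = -2n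
η(x) and ρ commutes with φ. The soliton equation with one argument equal to ξ says that [v, ξ] =
grad f - 2cξ (`g_grad`).

Evaluating L_v L_ξ g - L_ξ L_v g = L_[v,ξ] g expresses L_v φ through ρ and Hess f (`lie_φ`), and φ²
= I - η ⊗ ξ turns this into a formula for ρ in terms of c and f (`hess_φ`). The field U = 2v - 2fξ -
φ grad f is horizontal and commutes with ξ, and ρ cancels from L_U g (`lie_corrected_g`). Commuting
L_U with L_ξ gives L_U φ = -2cφ (`lie_corrected_φ`). But U preserves ξ and η, hence φ², so c φ² = 0
and c = 0 as soon as n > 0.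

Now U preserves φ, and T = L_U ∇ is symmetric, φ-linear up to multiples of ξ, and satisfies
g(T(x,y),z) + g(y,T(x,z)) = -4 df(x) g(y,φz) on horizontal fields. This forces df(φz) g(x,y) = df(z)
g(x,φy) there (`grad_φ`). Taking traces, with tr φ = 0 and tr φ² = 2n, gives grad f = 0, and
`hess_φ` collapses to ρ = -2n η ⊗ η (`ricci_eq`).

For n > 0 it follows that [v, ξ] = 0 and L_v η = 0, so L_v ρ vanishes on ξ. Both metrics have η as
the dual of ξ and their Ricci tensors agree (`ricci_assoc`), so both scalar curvatures are -2n. If n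
= 0, ξ spans each tangent space and ρ = 0.

The tensor calculus is carried out algebraically, for a module of fields over a ring of functions;
traces enter through cut-off local frames. -/

namespace PiGeometry

/-! ### Algebra of vector fields: torsion-free connections and their curvature. -/

/-- The algebraic structure carried by the vector fields `V` over the ring of functions `A`. -/
structure FieldCalculus (A V : Type*) [CommRing A] [AddCommGroup V] [Module A V] where
  act : V →ₗ[A] A →+ A
  br : V →+ V →+ V
  act_mul : ∀ x a b, act x (a * b) = act x a * b + a * act x b
  br_smul : ∀ x a y, br x (a • y) = act x a • y + a • br x y
  br_swap : ∀ x y, br x y = -br y x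
  jacobi : ∀ x y z, br x (br y z) = br (br x y) z + br y (br x z)
  act_br : ∀ x y a, act (br x y) a = act x (act y a) - act y (act x a)

namespace FieldCalculus

variable {A V : Type*} [CommRing A] [AddCommGroup V] [Module A V] (C : FieldCalculus A V)

/-- A torsion free connection. -/
structure Connection where
  nab : V →ₗ[A] V →+ V
  leibniz : ∀ x a y, nab x (a • y) = C.act x a • y + a • nab x y
  torsion_free : ∀ x y, C.br x y = nab x y - nab y x

variable {C}

lemma act_one (x : V) : C.act x 1 = 0 := by
  have h := C.act_mul x 1 1
  simpa using h

lemma act_two (x : V) : C.act x 2 = 0 := by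
  rw [← one_add_one_eq_two, map_add, act_one, add_zero]

lemma act_two_mul (x : V) (a : A) : C.act x (2 * a) = 2 * C.act x a := by
  rw [two_mul, map_add, two_mul]

lemma smul_br (x : V) (a : A) (y : V) : C.br (a • x) y = a • C.br x y - C.act y a • x := by
  rw [C.br_swap, C.br_smul, C.br_swap y x]; module

namespace Connection

variable (D : Connection C)

/-- The curvature of a connection. -/
def curv (x y z : V) : V :=
  D.nab x (D.nab y z) - D.nab y (D.nab x z) - D.nab (C.br x y) z

lemma curv_add₁ (x x' y z : V) : D.curv (x + x') y z = D.curv x y z + D.curv x' y z := by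
  simp only [curv, map_add, AddMonoidHom.add_apply]; abel

lemma curv_add₂ (x y y' z : V) : D.curv x (y + y') z = D.curv x y z + D.curv x y' z := by
  simp only [curv, map_add, AddMonoidHom.add_apply]; abel

lemma curv_add₃ (x y z z' : V) : D.curv x y (z + z') = D.curv x y z + D.curv x y z' := by
  simp only [curv, map_add]; abel

lemma curv_swap (x y z : V) : D.curv x y z = -D.curv y x z := by
  simp only [curv]; rw [C.br_swap x y]; simp only [map_neg, AddMonoidHom.neg_apply]; abel

lemma curv_smul₁ (a : A) (x y z : V) : D.curv (a • x) y z = a • D.curv x y z := by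
  simp only [curv, smul_br, map_smul, map_sub, AddMonoidHom.smul_apply, AddMonoidHom.sub_apply,
    D.leibniz]
  module

lemma curv_smul₂ (a : A) (x y z : V) : D.curv x (a • y) z = a • D.curv x y z := by
  rw [D.curv_swap, D.curv_smul₁, D.curv_swap y]; module

lemma curv_smul₃ (a : A) (x y z : V) : D.curv x y (a • z) = a • D.curv x y z := by
  simp only [curv, map_add, D.leibniz, C.act_br]
  module

/-- The curvature as a trilinear map. -/
def curvₗ : V →ₗ[A] V →ₗ[A] V →ₗ[A] V :=
  LinearMap.mk₂ A (fun x y ↦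
    { toFun := D.curv x y, map_add' := D.curv_add₃ x y,
      map_smul' := fun a z ↦ D.curv_smul₃ a x y z })
    (fun x x' y ↦ by ext z; exact D.curv_add₁ x x' y z)
    (fun a x y ↦ by ext z; exact D.curv_smul₁ a x y z)
    (fun x y y' ↦ by ext z; exact D.curv_add₂ x y y' z)
    (fun a x y ↦ by ext z; exact D.curv_smul₂ a x y z)

/-- This is the Jacobi identity, once torsion-freeness turns each bracket into a difference of
covariant derivatives. -/
lemma bianchi (x y z : V) : D.curv x y z + D.curv y z x + D.curv z x y = 0 := by
  have h1 := C.jacobi x y z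
  have e1 : D.nab x (C.br y z) = D.nab x (D.nab y z) - D.nab x (D.nab z y) := by
    rw [D.torsion_free y z, map_sub]
  have e2 : D.nab y (C.br x z) = D.nab y (D.nab x z) - D.nab y (D.nab z x) := by
    rw [D.torsion_free x z, map_sub]
  have e3 : D.nab z (C.br x y) = D.nab z (D.nab x y) - D.nab z (D.nab y x) := by
    rw [D.torsion_free x y, map_sub]
  have e4 : D.nab (C.br z x) y = -D.nab (C.br x z) y := by
    rw [C.br_swap z x]; simp
  rw [D.torsion_free (C.br x y), D.torsion_free x, D.torsion_free y (C.br x z)] at h1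
  simp only [curv]
  linear_combination (norm := module) h1 - e1 + e2 - e3 - e4

/-- A symmetric form is parallel. -/
structure IsMetric (h : V →ₗ[A] V →ₗ[A] A) : Prop where
  symm : ∀ x y, h x y = h y x
  compat : ∀ x y z, C.act x (h y z) = h (D.nab x y) z + h y (D.nab x z)

variable {D} {h : V →ₗ[A] V →ₗ[A] A}

/-- Second derivatives of the function h(z, w) commute up to the bracket; the mixed terms cancel and
leave the curvature. -/
lemma IsMetric.curv_skew (H : D.IsMetric h) (x y z w : V) :
    h (D.curv x y z) w = -h z (D.curv x y w) := by
  have h1 := C.act_br x y (h z w)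
  simp only [H.compat, map_add] at h1
  simp only [curv, map_sub, LinearMap.sub_apply]
  linear_combination -h1

lemma IsMetric.curv_pair (two : ∀ a : A, 2 * a = 0 → a = 0) (H : D.IsMetric h) (x y z w : V) :
    h (D.curv x y z) w = h (D.curv z w x) y := by
  have b (x y z w : V) : h (D.curv x y z) w + h (D.curv y z x) w + h (D.curv z x y) w = 0 := by
    have := congrArg (fun t ↦ h t w) (D.bianchi x y z)
    simpa using this
  have s (x y z w : V) : h (D.curv x y z) w = -h (D.curv x y w) z := by
    rw [H.curv_skew, H.symm]
  have t (x y z w : V) : h (D.curv x y z) w = -h (D.curv y x z) w := by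
    rw [D.curv_swap]; simp
  rw [← sub_eq_zero]
  apply two
  -- The octahedron argument: four Bianchi identities, rewritten by the two skew symmetries, combine
  -- to twice the difference.
  have h1 := b x y z w
  have h2 := b y z w x
  have h3 := b z w x y
  have h4 := b w x y z
  rw [t z x y w, s x z y w] at h1
  rw [s y z w x, s z w y x, s w y z x, t w y x z] at h2
  rw [t w x z y, s x w z y, t x z w y] at h3
  rw [s w x y z, s x y w z, t y w x z] at h4
  linear_combination h1 + h2 - h3 - h4 - t z x w y - t w y x z - t w x z y + s x w z y

end Connection
end FieldCalculus

/-! ### Para-Sasaki-like structures: derivatives of ξ, η and φ, and the curvature on ξ. -/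

namespace FieldCalculus

variable {A V : Type*} [CommRing A] [AddCommGroup V] [Module A V] {C : FieldCalculus A V}

/-- The algebraic form of a para-Sasaki-like structure `(φ, ξ, η, g)`. -/
structure ParaSasaki (D : Connection C) where
  g : V →ₗ[A] V →ₗ[A] A
  φ : V →ₗ[A] V
  ξ : V
  η : V →ₗ[A] A
  metric : D.IsMetric g
  φ_ξ : φ ξ = 0
  φ_sq : ∀ x, φ (φ x) = x - η x • ξ
  η_φ : ∀ x, η (φ x) = 0
  η_ξ : η ξ = 1
  g_ξ : ∀ x, g x ξ = η x
  g_φ : ∀ x y, g (φ x) y = g x (φ y)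
  nab_φ : ∀ x y, D.nab x (φ y)
    = φ (D.nab x y) - g x y • ξ - η y • x + (2 * η x * η y) • ξ
  two : ∀ a : A, 2 * a = 0 → a = 0
  nondeg : ∀ x, (∀ z, g x z = 0) → x = 0

namespace ParaSasaki

variable {D : Connection C} (S : ParaSasaki D)

lemma g_ξ_left (x : V) : S.g S.ξ x = S.η x := by rw [S.metric.symm, S.g_ξ]

lemma g_φφ (x y : V) : S.g x (S.φ (S.φ y)) = S.g x y - S.η x * S.η y := by
  rw [S.φ_sq]; simp [S.g_ξ, mul_comm]

lemma ext_g {x y : V} (h : ∀ z, S.g z x = S.g z y) : x = y := by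
  rw [← sub_eq_zero]
  refine S.nondeg _ fun z ↦ ?_
  rw [S.metric.symm, map_sub, h, sub_self]

lemma g_φ_comm (x y : V) : S.g x (S.φ y) = S.g y (S.φ x) := by
  rw [← S.g_φ, S.metric.symm]

lemma two_cancel (S : ParaSasaki D) {a b : A} (h : 2 * a = 2 * b) : a = b := by
  rw [← sub_eq_zero]; exact S.two _ (by rw [mul_sub, h, sub_self])

lemma η_nab_ξ (x : V) : S.η (D.nab x S.ξ) = 0 := by
  have h := S.metric.compat x S.ξ S.ξ
  rw [S.g_ξ, S.η_ξ, act_one, S.g_ξ, S.g_ξ_left] at h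
  exact S.two _ (by linear_combination -h)

/-- The defining identity at y = ξ reads φ(∇_x ξ) = x - η(x)ξ. Applying φ once more recovers ∇_x ξ,
because ∇_x ξ is horizontal. -/
lemma nab_ξ (x : V) : D.nab x S.ξ = S.φ x := by
  have h := S.nab_φ x S.ξ
  rw [S.φ_ξ, map_zero, S.g_ξ, S.η_ξ] at h
  have h2 : S.φ (D.nab x S.ξ) = x - S.η x • S.ξ := by
    linear_combination (norm := module) -h
  have h3 := congrArg S.φ h2
  rw [S.φ_sq, S.η_nab_ξ, map_sub, map_smul, S.φ_ξ] at h3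
  simpa using h3

lemma act_η (x y : V) : C.act x (S.η y) = S.η (D.nab x y) + S.g y (S.φ x) := by
  rw [← S.g_ξ, S.metric.compat, S.g_ξ, S.nab_ξ]

/-- η is closed because ∇ξ = φ is self-adjoint. -/
lemma dη (x y : V) : C.act x (S.η y) - C.act y (S.η x) = S.η (C.br x y) := by
  rw [S.act_η, S.act_η, D.torsion_free, map_sub, ← S.g_φ y x, S.metric.symm (S.φ y) x]; ring

lemma br_ξ (x : V) : C.br S.ξ x = D.nab S.ξ x - S.φ x := by
  rw [D.torsion_free, S.nab_ξ]

lemma lie_ξ_η (x : V) : C.act S.ξ (S.η x) = S.η (C.br S.ξ x) := by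
  rw [← S.dη, S.η_ξ, act_one, sub_zero]

lemma lie_ξ_φ (x : V) : C.br S.ξ (S.φ x) = S.φ (C.br S.ξ x) := by
  rw [S.br_ξ, S.br_ξ, S.nab_φ, map_sub, S.g_ξ_left, S.η_ξ]; module

lemma lie_ξ_g (x y : V) : C.act S.ξ (S.g x y)
    = S.g (C.br S.ξ x) y + S.g x (C.br S.ξ y) + 2 * S.g x (S.φ y) := by
  rw [S.metric.compat, S.br_ξ, S.br_ξ]
  simp only [map_sub, LinearMap.sub_apply, S.g_φ]; ring

lemma curv_ξ (x y : V) : D.curv x y S.ξ = S.η x • y - S.η y • x := by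
  simp only [Connection.curv, S.nab_ξ, S.nab_φ, D.torsion_free x y, map_sub,
    AddMonoidHom.sub_apply]
  rw [S.metric.symm y x]
  module

lemma nab_g_φ (x y z : V) : C.act x (S.g y (S.φ z)) = S.g (D.nab x y) (S.φ z)
    + S.g y (S.φ (D.nab x z)) - S.g x z * S.η y - S.η z * S.g x y + 2 * S.η x * S.η y * S.η z := by
  rw [S.metric.compat, S.nab_φ]
  simp only [map_sub, map_add, map_smul, S.g_ξ, smul_eq_mul, S.metric.symm y x]; ring

/-- The Ricci identity for `φ`. -/
lemma curv_φ (x y z : V) : D.curv x y (S.φ z) = S.φ (D.curv x y z)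
    - S.g y z • S.φ x + S.g x z • S.φ y - S.g x (S.φ z) • y + S.g y (S.φ z) • x
    + (2 * (S.η y * S.g x (S.φ z) - S.η x * S.g y (S.φ z))) • S.ξ
    + (2 * S.η z) • (S.η y • S.φ x - S.η x • S.φ y) := by
  simp only [Connection.curv, S.nab_φ, D.leibniz, S.nab_ξ, map_sub, map_add,
    S.metric.compat, S.act_η, C.act_mul, act_two, D.torsion_free x y,
    AddMonoidHom.sub_apply, mul_assoc]
  rw [S.g_φ_comm z x, S.g_φ_comm z y, S.g_φ_comm y x]
  module

end ParaSasaki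

/-! ### Lie derivatives along ξ, and the Levi-Civita connection of the associated metric. -/

namespace ParaSasaki

variable {D : Connection C} (S : ParaSasaki D)

lemma curv_ξ_left (x y : V) : D.curv S.ξ x y = S.η y • x - S.g x y • S.ξ := by
  refine S.ext_g fun w ↦ ?_
  rw [S.metric.symm, S.metric.curv_pair S.two, S.curv_ξ]
  simp only [map_sub, map_smul, LinearMap.sub_apply, LinearMap.smul_apply, S.g_ξ, smul_eq_mul]
  rw [S.metric.symm x y]; ring

/-- The Lie derivative of the connection along `ξ`. -/
lemma lie_ξ_nab (x y : V) : C.br S.ξ (D.nab x y)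
    = D.nab (C.br S.ξ x) y + D.nab x (C.br S.ξ y) - (2 * (S.g x y - S.η x * S.η y)) • S.ξ := by
  -- The Lie derivative of a torsion-free connection along ξ is R(ξ, x)y plus the second covariant
  -- derivative of ξ, and the latter is ∇φ.
  have h := S.curv_ξ_left x y
  rw [Connection.curv, S.br_ξ, map_sub, AddMonoidHom.sub_apply] at h
  rw [S.br_ξ, S.br_ξ, S.br_ξ, map_sub, map_sub, AddMonoidHom.sub_apply, S.nab_φ]
  linear_combination (norm := module) h

/-- The Lie derivative of the curvature along `ξ`. -/
lemma lie_ξ_curv (x y z : V) : C.br S.ξ (D.curv x y z)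
    = D.curv (C.br S.ξ x) y z + D.curv x (C.br S.ξ y) z + D.curv x y (C.br S.ξ z)
      - (2 * (S.η x * S.g y (S.φ z) - S.η y * S.g x (S.φ z))) • S.ξ
      - (2 * (S.g y z - S.η y * S.η z)) • S.φ x + (2 * (S.g x z - S.η x * S.η z)) • S.φ y := by
  simp only [Connection.curv, map_sub, map_add, S.lie_ξ_nab, C.jacobi S.ξ x y, D.leibniz,
    C.act_mul, act_two, S.metric.compat, S.act_η, S.nab_ξ, AddMonoidHom.add_apply]
  rw [D.torsion_free x y]
  simp only [map_sub, LinearMap.sub_apply]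
  rw [S.g_φ_comm y x, S.g_φ_comm z x, S.g_φ_comm z y]
  module

section Associated

variable {D' : Connection C} {h : V →ₗ[A] V →ₗ[A] A}

/-- The Levi-Civita connection of the associated metric. -/
lemma nab_associated (hh : ∀ x y, h x y = S.g x (S.φ y) + S.η x * S.η y) (H : D'.IsMetric h)
    (x y : V) :
    D'.nab x y = D.nab x y + (S.g x (S.φ y) - S.g x y + S.η x * S.η y) • S.ξ := by
  set T : V → V → V := fun x y ↦
    D'.nab x y - D.nab x y - (S.g x (S.φ y) - S.g x y + S.η x * S.η y) • S.ξ with hT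
  have T_symm (x y : V) : T x y = T y x := by
    have h1 := D'.torsion_free x y
    rw [D.torsion_free x y] at h1
    simp only [hT]
    rw [S.g_φ_comm y x, S.metric.symm y x, mul_comm (S.η y)]
    linear_combination (norm := module) -h1
  have T_skew (x y z : V) : h (T x y) z = -h (T x z) y := by
    have h1 := H.compat x y z
    have h2 : C.act x (h y z) = S.g (D.nab x y) (S.φ z) + S.g y (S.φ (D.nab x z))
        - S.g x z * S.η y - S.η z * S.g x y + 2 * S.η x * S.η y * S.η z
        + (S.η (D.nab x y) + S.g y (S.φ x)) * S.η z
        + S.η y * (S.η (D.nab x z) + S.g z (S.φ x)) := by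
      rw [hh, map_add, C.act_mul, S.nab_g_φ, S.act_η, S.act_η]; ring
    rw [h2, hh, hh, S.g_φ_comm y x, S.g_φ_comm z x, S.g_φ_comm y (D'.nab x z),
      S.g_φ_comm y (D.nab x z)] at h1
    simp only [hT, hh, map_sub, map_smul, LinearMap.sub_apply, LinearMap.smul_apply, smul_eq_mul,
      S.g_ξ_left, S.η_φ, S.η_ξ]
    linear_combination -h1
  have T_zero (x y z : V) : h (T x y) z = 0 := by
    refine S.two _ ?_
    -- The uniqueness argument for Levi-Civita connections: a tensor symmetric in one pair of slots
    -- and skew in another vanishes.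
    have e : h (T x y) z = -h (T x y) z := by
      calc h (T x y) z = -h (T z x) y := by rw [T_skew, T_symm x z]
        _ = h (T y z) x := by rw [T_skew, T_symm z y, neg_neg]
        _ = -h (T x y) z := by rw [T_skew, T_symm y x]
    linear_combination e
  have T_eq : T x y = 0 := by
    have hη : S.η (T x y) = 0 := by
      have := T_zero x y S.ξ
      rwa [hh, S.φ_ξ, map_zero, S.η_ξ, zero_add, mul_one] at this
    refine S.nondeg _ fun z ↦ ?_
    -- Testing against φz turns the associated metric back into g, since the η-component of T is
    -- already zero.
    have := T_zero x y (S.φ z)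
    rwa [hh, S.g_φφ, hη, S.η_φ, zero_mul, sub_zero, zero_mul, add_zero] at this
  simp only [hT] at T_eq
  linear_combination (norm := module) T_eq

/-- The curvature of the Levi-Civita connection of the associated metric. -/
lemma curv_associated (hh : ∀ x y, h x y = S.g x (S.φ y) + S.η x * S.η y) (H : D'.IsMetric h)
    (x y z : V) :
    D'.curv x y z = D.curv x y z
      + (S.η y * S.g x (S.φ z) - S.η x * S.g y (S.φ z) - S.η y * S.g x z + S.η x * S.g y z) • S.ξ
      + (S.g y (S.φ z) - S.g y z + S.η y * S.η z) • S.φ x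
      - (S.g x (S.φ z) - S.g x z + S.η x * S.η z) • S.φ y := by
  simp only [Connection.curv, S.nab_associated hh H, map_add, map_sub, D.leibniz, S.nab_g_φ,
    S.nab_ξ, S.metric.compat, S.act_η, C.act_mul, map_smul, S.φ_ξ, S.g_ξ, S.η_ξ, smul_eq_mul,
    map_zero, smul_zero, D.torsion_free x y, AddMonoidHom.sub_apply]
  rw [S.g_φ_comm y x, S.g_φ_comm z x, S.g_φ_comm z y, S.metric.symm y x]
  module

end Associated

end ParaSasaki

/-! ### The soliton equation: vanishing of the constant c and the constraint on the gradient of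
η(v). -/

namespace ParaSasaki

variable {D : Connection C}

/-- The vector field `[v, ξ] + 2cξ`; for a soliton with potential `v` it is the gradient
of `η v`. -/
def grad (S : ParaSasaki D) (v : V) (c : A) : V := C.br v S.ξ + (2 * c) • S.ξ

lemma br_eq_grad (S : ParaSasaki D) (v : V) (c : A) :
    C.br v S.ξ = S.grad v c - (2 * c) • S.ξ := by
  rw [grad]; module

/-- Twice the potential, corrected so as to be horizontal and invariant under `ξ`. -/
def corrected (S : ParaSasaki D) (v : V) (c : A) : V :=
  (2 : A) • v - (2 * S.η v) • S.ξ - S.φ (S.grad v c)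

lemma η_corrected (S : ParaSasaki D) (v : V) (c : A) : S.η (S.corrected v c) = 0 := by
  simp [corrected, S.η_φ, S.η_ξ]

/-- The soliton equation with potential `v` for a symmetric tensor `ρ` that has the properties of
the Ricci tensor of a para-Sasaki-like structure of dimension `N + 1`. -/
structure Soliton (S : ParaSasaki D) (v : V) (ρ : V → V → A) (lam mu nu N : A) : Prop where
  act_lam : ∀ x, C.act x lam = 0
  act_mu : ∀ x, C.act x mu = 0
  act_nu : ∀ x, C.act x nu = 0
  act_N : ∀ x, C.act x N = 0
  ρ_ξ : ∀ x, ρ x S.ξ = -N * S.η x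
  ρ_φφ : ∀ x y, ρ (S.φ x) (S.φ y) = ρ x y + N * S.η x * S.η y
  ρ_φ_sq : ∀ x y, ρ x (S.φ (S.φ y)) = ρ x y + N * S.η x * S.η y
  ρ_lie : ∀ x y, C.act S.ξ (ρ x y) = ρ (C.br S.ξ x) y + ρ x (C.br S.ξ y)
  eqn : ∀ x y, C.act v (S.g x y) = S.g (C.br v x) y + S.g x (C.br v y) - 2 * ρ x y
    - 2 * lam * S.g x y - 2 * mu * (S.g x (S.φ y) + S.η x * S.η y) - 2 * nu * (S.η x * S.η y)

namespace Soliton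

variable {S : ParaSasaki D} {v : V} {ρ : V → V → A} {lam mu nu N : A}
  (H : S.Soliton v ρ lam mu nu N)

include H

lemma act_const (x : V) : C.act x (N - lam - mu - nu) = 0 := by
  simp [H.act_N, H.act_lam, H.act_mu, H.act_nu]

lemma g_grad (x : V) : S.g x (S.grad v (N - lam - mu - nu)) = C.act x (S.η v) := by
  have h1 := H.eqn x S.ξ
  have h2 := S.dη v x
  rw [S.g_ξ, S.g_ξ, S.φ_ξ, map_zero, S.η_ξ, H.ρ_ξ] at h1
  rw [grad, map_add, map_smul, S.g_ξ, smul_eq_mul]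
  linear_combination h2 - h1

/-- As a gradient its η-component is ξ(η v) = -η([v, ξ]); by definition it is η([v, ξ]) + 2c. Adding
the two eliminates the bracket. -/
lemma η_grad : S.η (S.grad v (N - lam - mu - nu)) = N - lam - mu - nu := by
  have h1 := H.g_grad S.ξ
  rw [S.g_ξ_left, S.lie_ξ_η, C.br_swap, map_neg] at h1
  have h2 : S.η (S.grad v (N - lam - mu - nu)) = S.η (C.br v S.ξ) + 2 * (N - lam - mu - nu) := by
    rw [grad, map_add, map_smul, S.η_ξ, smul_eq_mul, mul_one]
  exact S.two_cancel (by linear_combination h1 + h2)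

lemma hess_symm (x y : V) : S.g (D.nab x (S.grad v (N - lam - mu - nu))) y
    = S.g (D.nab y (S.grad v (N - lam - mu - nu))) x := by
  have h := C.act_br x y (S.η v)
  simp only [← H.g_grad, S.metric.compat, D.torsion_free x y, map_sub,
    AddMonoidHom.sub_apply] at h
  rw [S.metric.symm _ y, S.metric.symm _ x]
  linear_combination -h

lemma lie_grad_g (x y : V) :
    C.act (S.grad v (N - lam - mu - nu)) (S.g x y)
    = S.g (C.br (S.grad v (N - lam - mu - nu)) x) y + S.g x (C.br (S.grad v (N - lam - mu - nu)) y)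
      + 2 * S.g (D.nab x (S.grad v (N - lam - mu - nu))) y := by
  rw [S.metric.compat, D.torsion_free _ x, D.torsion_free _ y]
  simp only [map_sub, LinearMap.sub_apply]
  rw [S.metric.symm x (D.nab y _), H.hess_symm y x]
  ring

/-- The Lie derivative of `φ` along the potential. -/
lemma lie_φ (x y : V) : S.g x (C.br v (S.φ y) - S.φ (C.br v y))
    = 2 * ρ x (S.φ y) - 2 * (N - lam - mu - nu) * S.g x (S.φ y)
      + S.g (D.nab x (S.grad v (N - lam - mu - nu))) y := by
  set c := N - lam - mu - nu with hc
  -- The commutator of L_v and L_ξ on g. Since L_ξ g = 2g(·, φ·), the term L_v L_ξ g contains L_v φ;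
  -- since ξ preserves ρ, the term L_ξ L_v g brings in no derivative of ρ.
  have h := C.act_br v S.ξ (S.g x y)
  have e1 := H.lie_grad_g x y
  rw [← hc] at e1
  have e2 := S.lie_ξ_g x y
  have j1 := C.jacobi v S.ξ x
  have j2 := C.jacobi v S.ξ y
  rw [S.br_eq_grad v c, map_sub, map_smul] at h
  have b (z : V) : C.br (C.br v S.ξ) z = C.br (S.grad v c) z - (2 * c) • C.br S.ξ z := by
    rw [S.br_eq_grad v c, map_sub, AddMonoidHom.sub_apply, smul_br, act_two_mul,
      H.act_const, mul_zero, zero_smul, sub_zero]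
  rw [b] at j1 j2
  simp only [AddMonoidHom.sub_apply, AddMonoidHom.smul_apply, smul_eq_mul] at h
  rw [e1, e2, H.eqn x y] at h
  simp only [map_add, map_sub, C.act_mul, act_two, S.lie_ξ_g, H.ρ_lie, H.act_lam, H.act_mu,
    H.act_nu, S.lie_ξ_η, H.eqn, S.lie_ξ_φ, S.g_φφ, S.η_φ, j1, j2, LinearMap.add_apply,
    LinearMap.sub_apply, map_smul, LinearMap.smul_apply, smul_eq_mul] at h
  rw [map_sub]
  refine S.two_cancel ?_
  linear_combination -h

/-- Anticommute L_v φ with φ: the result is L_v(φ²) = -L_v(η ⊗ ξ), which involves only [v, ξ] and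
the differential of η(v). -/
lemma hess_φ (x y : V) :
    4 * ρ x y + 4 * N * S.η x * S.η y
      - 4 * (N - lam - mu - nu) * (S.g x y - S.η x * S.η y)
      + S.g (D.nab x (S.grad v (N - lam - mu - nu))) (S.φ y)
      + S.g (D.nab (S.φ x) (S.grad v (N - lam - mu - nu))) y
    = -S.g y (S.grad v (N - lam - mu - nu)) * S.η x
      - S.g x (S.grad v (N - lam - mu - nu)) * S.η y
      + 2 * (N - lam - mu - nu) * S.η x * S.η y := by
  have h1 := H.lie_φ x (S.φ y)
  have h2 := H.lie_φ (S.φ x) y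
  have h3 := S.dη v y
  have h4 := S.br_eq_grad v (N - lam - mu - nu)
  rw [S.φ_sq y, map_sub, map_sub, C.br_smul, h4] at h1
  simp only [← S.φ_sq, H.ρ_φ_sq, H.ρ_φφ, S.g_φφ, S.g_φ, map_sub, map_add, map_smul, S.g_ξ,
    smul_eq_mul, ← H.g_grad] at h1 h2 h3
  linear_combination -h1 - h2 - S.η x * h3

/-- The function η(v) has constant derivative along ξ, so its differential is ξ-invariant; only L_ξ
g = 2g(·, φ·) contributes. -/
lemma br_ξ_grad : C.br S.ξ (S.grad v (N - lam - mu - nu))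
    = -((2 : A) • S.φ (S.grad v (N - lam - mu - nu))) := by
  refine S.ext_g fun x ↦ ?_
  have h1 := C.act_br S.ξ x (S.η v)
  have h2 := S.lie_ξ_g x (S.grad v (N - lam - mu - nu))
  rw [← H.g_grad, ← H.g_grad, ← H.g_grad, S.g_ξ_left, H.η_grad, H.act_const] at h1
  rw [map_neg, map_smul, smul_eq_mul]
  linear_combination -h1 - h2

lemma br_ξ_corrected : C.br S.ξ (S.corrected v (N - lam - mu - nu)) = 0 := by
  have h1 : C.act S.ξ (S.η v) = N - lam - mu - nu := by
    rw [← H.g_grad, S.g_ξ_left, H.η_grad]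
  have h2 : C.br S.ξ S.ξ = 0 := by rw [S.br_ξ, S.nab_ξ, sub_self]
  rw [corrected, map_sub, map_sub, C.br_smul, C.br_smul, S.lie_ξ_φ, H.br_ξ_grad, act_two_mul,
    act_two, h1, h2, C.br_swap, S.br_eq_grad v (N - lam - mu - nu), map_neg, map_smul, S.φ_sq,
    H.η_grad]
  module

/-- The correction is chosen for this: the φ grad term produces exactly the Hessian terms that
`hess_φ` trades for ρ, and the ξ term absorbs the products of η with the differential of η(v). -/
lemma lie_corrected_g (x y : V) : C.act (S.corrected v (N - lam - mu - nu)) (S.g x y)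
    = S.g (C.br (S.corrected v (N - lam - mu - nu)) x) y
      + S.g x (C.br (S.corrected v (N - lam - mu - nu)) y)
      - (4 * lam + 2 * (N - lam - mu - nu)) * (S.g x y - S.η x * S.η y)
      - 4 * (mu + S.η v) * S.g x (S.φ y) := by
  have h1 := H.hess_φ x y
  have h2 := H.hess_symm (S.φ x) y
  have h3 := H.η_grad
  rw [corrected]
  simp only [map_sub, map_smul, AddMonoidHom.sub_apply, AddMonoidHom.smul_apply, smul_br,
    act_two_mul, act_two, H.eqn, S.lie_ξ_g, ← H.g_grad]
  rw [S.metric.compat, D.torsion_free (S.φ _) x, D.torsion_free (S.φ _) y, S.nab_φ, S.nab_φ]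
  simp only [map_sub, map_smul, map_add, LinearMap.sub_apply, LinearMap.add_apply,
    LinearMap.smul_apply, smul_eq_mul, S.g_ξ, S.g_ξ_left, S.g_φ]
  rw [S.g_φ_comm x (D.nab y _), ← h2, h3]
  linear_combination -h1

/-- L_ξ and L_U commute on g because [ξ, U] = 0. All terms match except L_U φ and the one from ξ(η
v) = c, the derivative of the only non-constant coefficient of L_U g. -/
lemma lie_corrected_φ (y : V) : C.br (S.corrected v (N - lam - mu - nu)) (S.φ y)
    = S.φ (C.br (S.corrected v (N - lam - mu - nu)) y) - (2 * (N - lam - mu - nu)) • S.φ y := by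
  refine S.ext_g fun x ↦ ?_
  set U := S.corrected v (N - lam - mu - nu) with hU
  have h := C.act_br S.ξ U (S.g x y)
  have h0 : C.br S.ξ U = 0 := H.br_ξ_corrected
  have hη (z : V) : C.act U (S.η z) = S.η (C.br U z) := by
    rw [← S.dη, hU, S.η_corrected, map_zero, sub_zero]
  have j1 := C.jacobi S.ξ U x
  have j2 := C.jacobi S.ξ U y
  have hf : C.act S.ξ (S.η v) = N - lam - mu - nu := by
    rw [← H.g_grad, S.g_ξ_left, H.η_grad]
  have act_four : C.act S.ξ 4 = 0 := by
    rw [show (4 : A) = 2 * 2 by norm_num, act_two_mul, act_two, mul_zero]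
  have E := H.lie_corrected_g
  rw [← hU] at E
  rw [h0, map_zero, AddMonoidHom.zero_apply] at h j1 j2
  rw [zero_add] at j1 j2
  simp only [E, S.lie_ξ_g, map_add, map_sub, C.act_mul, act_two, act_four, H.act_lam, H.act_mu,
    H.act_nu, H.act_N, hf, S.lie_ξ_η, S.lie_ξ_φ, S.g_φφ, S.η_φ, j1, j2] at h
  rw [map_sub, map_smul, smul_eq_mul]
  refine S.two_cancel ?_
  linear_combination h

/-- U preserves ξ and η, hence φ² = I - η ⊗ ξ, while L_U φ = -2cφ would scale φ² by -4c. -/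
lemma const_smul_φ_sq (y : V) : (4 * (N - lam - mu - nu)) • S.φ (S.φ y) = 0 := by
  set U := S.corrected v (N - lam - mu - nu) with hU
  have hη : C.act U (S.η y) = S.η (C.br U y) := by
    rw [← S.dη, hU, S.η_corrected, map_zero, sub_zero]
  have hξ : C.br U S.ξ = 0 := by rw [C.br_swap, hU, H.br_ξ_corrected, neg_zero]
  have h1 := H.lie_corrected_φ (S.φ y)
  rw [H.lie_corrected_φ y, ← hU, map_sub, map_smul, S.φ_sq (C.br U y)] at h1
  have h2 : C.br U (S.φ (S.φ y)) = C.br U y - S.η (C.br U y) • S.ξ := by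
    rw [S.φ_sq, map_sub, C.br_smul, hξ, hη, smul_zero, add_zero]
  rw [h2] at h1
  linear_combination (norm := module) h1

/-- The gradient of `η v` is compatible with the conformal behaviour of the product structure. -/
lemma grad_φ (hc : N - lam - mu - nu = 0) {x y z : V} (hx : S.η x = 0) (hy : S.η y = 0)
    (hz : S.η z = 0) :
    S.g (S.φ z) (S.grad v 0) * S.g x y = S.g z (S.grad v 0) * S.g x (S.φ y) := by
  set U := S.corrected v 0 with hU
  have hη (z : V) : C.act U (S.η z) = S.η (C.br U z) := by
    rw [← S.dη, hU, S.η_corrected, map_zero, sub_zero]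
  have hf := H.g_grad
  have hξ := H.br_ξ_corrected
  have hφ := H.lie_corrected_φ
  have E := H.lie_corrected_g
  rw [hc, ← hU] at hξ
  simp only [hc, ← hU, mul_zero, add_zero, zero_smul, sub_zero] at hφ E hf
  have hξ' : C.br U S.ξ = 0 := by rw [C.br_swap, hξ, neg_zero]
  -- The Lie derivative of the connection along U. It is symmetric by the Jacobi identity and
  -- commutes with φ modulo ξ, because U preserves φ, ξ and η.
  set T : V → V → V := fun x y ↦ C.br U (D.nab x y) - D.nab (C.br U x) y - D.nab x (C.br U y)
    with hT
  have T_symm (x y : V) : T x y = T y x := by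
    have h1 := C.jacobi U x y
    rw [D.torsion_free x y, D.torsion_free (C.br U x), D.torsion_free x (C.br U y), map_sub] at h1
    simp only [hT]
    linear_combination (norm := module) h1
  have T_φ (x y z : V) (hz : S.η z = 0) : S.g (T x (S.φ y)) z = S.g (T x y) (S.φ z) := by
    have : T x (S.φ y) = S.φ (T x y)
        - (C.act U (S.g x y) - S.g (C.br U x) y - S.g x (C.br U y)) • S.ξ := by
      simp only [hT, S.nab_φ, hφ, map_sub, map_add, C.br_smul, hξ', hη, C.act_mul, act_two]
      module
    rw [this, map_sub, map_smul, LinearMap.sub_apply, LinearMap.smul_apply, S.g_ξ_left, hz, S.g_φ,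
      smul_zero, sub_zero]
  have act_four (x : V) : C.act x 4 = 0 := by
    rw [show (4 : A) = 2 * 2 by norm_num, act_two_mul, act_two, mul_zero]
  have T_g (x y z : V) (hx : S.η x = 0) (hy : S.η y = 0) (hz : S.η z = 0) :
      S.g (T x y) z + S.g y (T x z) = -4 * (S.g x (S.grad v 0) * S.g y (S.φ z)) := by
    -- Differentiating L_U g covariantly: on horizontal arguments only its non-constant coefficient,
    -- which involves η(v), contributes.
    have h1 := C.act_br U x (S.g y z)
    rw [S.metric.compat (C.br U x), S.metric.compat x y z, map_add, E (D.nab x y) z,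
      E y (D.nab x z), E y z] at h1
    simp only [S.metric.compat, map_add, C.act_mul, map_sub, act_four, H.act_lam,
      H.act_mu, S.act_η, hy, hz] at h1
    have h2 := (hf x).trans (S.act_η x v)
    have h3 : S.g y (D.nab x (S.φ z)) = S.g y (S.φ (D.nab x z)) := by
      rw [S.nab_φ]; simp [hx, hy, hz, S.g_ξ]
    simp only [hT, map_sub, LinearMap.sub_apply]
    linear_combination -h1 + 4 * S.g y (S.φ z) * h2 - 4 * (mu + S.η v) * h3
  have sq {x : V} (hx : S.η x = 0) : S.φ (S.φ x) = x := by
    rw [S.φ_sq, hx, zero_smul, sub_zero]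
  -- Replacing (z, x) by (φz, φx) leaves the left side of `T_g` unchanged, since φ moves freely
  -- between the slots of T and squares to the identity on horizontal fields. The two right sides
  -- must therefore agree.
  have h1 := T_g z x y hz hx hy
  have h2 := T_g (S.φ z) (S.φ x) y (S.η_φ z) (S.η_φ x) hy
  have e1 : S.g (T (S.φ z) (S.φ x)) y = S.g (T z x) y := by
    rw [T_φ _ _ _ hy, T_symm, T_φ _ _ _ (S.η_φ y), sq hy, T_symm]
  have e2 : S.g (S.φ x) (T (S.φ z) y) = S.g x (T z y) := by
    rw [S.metric.symm, T_symm, T_φ _ _ _ (S.η_φ x), sq hx, T_symm, S.metric.symm]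
  rw [e1, e2, h1, S.g_φ x, sq hy] at h2
  refine S.two_cancel (S.two_cancel ?_)
  linear_combination h2

end Soliton

end ParaSasaki

end FieldCalculus

/-! ### Smooth functions and fields on a manifold: cutoffs, extensions and local frames. -/

noncomputable section

open Filter Topology

variable (E : Type*) [NormedAddCommGroup E] [NormedSpace ℝ E]
  (M : Type*) [TopologicalSpace M] [ChartedSpace E M]

/-- Smooth functions. -/
abbrev SmoothFun := C^∞⟮𝓘(ℝ, E), M; 𝓘(ℝ, ℝ), ℝ⟯

variable [IsManifold 𝓘(ℝ, E) ∞ M]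

/-- Bundled smooth vector fields. -/
abbrev SmoothField := Cₛ^∞⟮𝓘(ℝ, E); E, (TangentSpace 𝓘(ℝ, E) : M → Type _)⟯

variable {E M}

namespace SmoothField

instance : SMul (SmoothFun E M) (SmoothField E M) :=
  ⟨fun a X ↦ ⟨fun p ↦ a p • X p, a.contMDiff.smul_section X.contMDiff⟩⟩

@[simp] lemma smul_apply (a : SmoothFun E M) (X : SmoothField E M) (p : M) :
    (a • X) p = a p • X p := rfl

@[simp] lemma add_apply (X Y : SmoothField E M) (p : M) : (X + Y) p = X p + Y p := rfl

@[simp] lemma sub_apply (X Y : SmoothField E M) (p : M) : (X - Y) p = X p - Y p := rfl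

@[simp] lemma zero_apply (p : M) : (0 : SmoothField E M) p = 0 := rfl

instance : Module (SmoothFun E M) (SmoothField E M) where
  one_smul X := by ext p; exact one_smul ℝ (X p)
  mul_smul a b X := by ext p; exact mul_smul (a p) (b p) (X p)
  smul_zero a := by ext p; exact smul_zero (a p)
  smul_add a X Y := by ext p; exact smul_add (a p) (X p) (Y p)
  add_smul a b X := by ext p; exact add_smul (a p) (b p) (X p)
  zero_smul X := by ext p; exact zero_smul ℝ (X p)

/-- Evaluation at a point. -/
def evalHom (p : M) : SmoothField E M →+ TangentSpace 𝓘(ℝ, E) p where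
  toFun X := X p
  map_zero' := rfl
  map_add' _ _ := rfl

lemma sum_apply {ι : Type*} (s : Finset ι) (X : ι → SmoothField E M) (p : M) :
    (∑ i ∈ s, X i) p = ∑ i ∈ s, X i p := map_sum (evalHom p) X s

lemma isSmoothField (X : SmoothField E M) : IsSmoothField (fun p ↦ X p) := X.contMDiff

end SmoothField

section Bump

variable [FiniteDimensional ℝ E] [T2Space M]

lemma exists_bump (p : M) {u : Set M} (hu : u ∈ 𝓝 p) :
    ∃ f : SmoothFun E M, tsupport f ⊆ u ∧ ∀ᶠ q in 𝓝 p, f q = 1 := by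
  obtain ⟨f, -, hf⟩ := (SmoothBumpFunction.nhds_basis_tsupport (I := 𝓘(ℝ, E)) p).mem_iff.1 hu
  exact ⟨⟨f, f.contMDiff⟩, hf, f.eventuallyEq_one⟩

/-- Every tangent vector is the value of a smooth vector field that agrees near the base point
with the standard local extension. -/
lemma exists_smoothField (p : M) (w : TangentSpace 𝓘(ℝ, E) p) :
    ∃ X : SmoothField E M, X p = w ∧ ∀ᶠ q in 𝓝 p, X q = FiberBundle.extend E w q := by
  obtain ⟨s, hs, hw⟩ := FiberBundle.exists_contMDiffOn_extend (k := ∞) 𝓘(ℝ, E) E w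
  obtain ⟨f, hf, hf1⟩ := exists_bump (E := E) p (interior_mem_nhds.2 hs)
  have h : ∀ᶠ q in 𝓝 p, f q • FiberBundle.extend E w q = FiberBundle.extend E w q := by
    filter_upwards [hf1] with q hq
    rw [hq, one_smul]
  refine ⟨⟨fun q ↦ f q • FiberBundle.extend E w q, ?_⟩, ?_, h⟩
  · exact ContMDiffOn.smul_section_of_tsupport f.contMDiff.contMDiffOn isOpen_interior hf
      (hw.mono interior_subset)
  · have := h.self_of_nhds
    simpa using this

/-- A finite family of vector fields and one-forms that is a pair of dual frames near `p`. -/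
structure FrameAt (p : M) where
  χ : SmoothFun E M
  e : Fin (Module.finrank ℝ E) → SmoothField E M
  θ : Fin (Module.finrank ℝ E) → Π q : M, TangentSpace 𝓘(ℝ, E) q →ₗ[ℝ] ℝ
  smooth : ∀ i (X : SmoothField E M), ContMDiff 𝓘(ℝ, E) 𝓘(ℝ, ℝ) ∞ fun q ↦ θ i q (X q)
  χ_one : ∀ᶠ q in 𝓝 p, χ q = 1
  dual : ∀ q (w : TangentSpace 𝓘(ℝ, E) q), χ q • w = ∑ i, θ i q w • e i q

/-- Both the frame and the coframe of a trivialization are multiplied by a bump function f so as to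
extend by zero; this is why χ is f². -/
lemma exists_frameAt (p : M) : Nonempty (FrameAt (E := E) p) := by
  set t := trivializationAt E (TangentSpace 𝓘(ℝ, E) : M → Type _) p
  set b := Module.finBasis ℝ E
  have hp : p ∈ t.baseSet := FiberBundle.mem_baseSet_trivializationAt' p
  obtain ⟨f, hf, hf1⟩ := exists_bump (E := E) p (t.open_baseSet.mem_nhds hp)
  refine ⟨⟨f * f, fun i ↦ ⟨fun q ↦ f q • t.localFrame b i q, ?_⟩,
    fun i q ↦ f q • t.localFrameCoeff 𝓘(ℝ, E) b i q, fun i X ↦ ?_, ?_, fun q w ↦ ?_⟩⟩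
  · exact ContMDiffOn.smul_section_of_tsupport f.contMDiff.contMDiffOn t.open_baseSet hf
      (t.contMDiffOn_localFrame_baseSet ∞ b i)
  · refine contMDiff_of_tsupport fun x hx ↦ ?_
    have hx' : x ∈ t.baseSet := by
      refine hf (closure_mono (fun y hy ↦ ?_) hx)
      simp only [Function.mem_support] at hy ⊢
      contrapose! hy
      simp [hy]
    exact f.contMDiff.contMDiffAt.mul
      (contMDiffAt_localFrameCoeff b hx' X.contMDiff.contMDiffAt i)
  · filter_upwards [hf1] with q hq
    simp [hq]
  · by_cases hq : q ∈ t.baseSet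
    · obtain ⟨s, rfl⟩ : ∃ s : Π q : M, TangentSpace 𝓘(ℝ, E) q, s q = w :=
        ⟨FiberBundle.extend E w, by simp⟩
      have h := Bundle.Trivialization.eq_sum_localFrameCoeff_smul (I := 𝓘(ℝ, E)) (b := b)
        (s := s) hq
      change (f q * f q) • s q = ∑ i, (f q • t.localFrameCoeff 𝓘(ℝ, E) b i q) (s q) • (f q • t.localFrame b i q)
      conv_lhs => rw [h]
      rw [Finset.smul_sum]
      refine Finset.sum_congr rfl fun i _ ↦ ?_
      rw [LinearMap.smul_apply, smul_smul, smul_smul, smul_eq_mul]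
      congr 1; ring
    · have h0 : f q = 0 := image_eq_zero_of_notMem_tsupport fun h ↦ hq (hf h)
      simp [h0]

end Bump
end

/-! ### The calculus of smooth vector fields and the connection induced by a covariant derivative.
-/

noncomputable section

open Filter Topology

set_option linter.unusedSectionVars false

variable {E : Type*} [NormedAddCommGroup E] [NormedSpace ℝ E]
  {M : Type*} [TopologicalSpace M] [ChartedSpace E M]

lemma SmoothFun.mdiffAt (f : SmoothFun E M) (p : M) :
    MDifferentiableAt 𝓘(ℝ, E) 𝓘(ℝ, ℝ) f p := f.contMDiff.mdifferentiableAt (by simp)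

variable [IsManifold 𝓘(ℝ, E) ∞ M]

lemma SmoothField.mdiffAt (X : SmoothField E M) (p : M) :
    MDifferentiableAt 𝓘(ℝ, E) 𝓘(ℝ, E).tangent
      (fun q ↦ (⟨q, X q⟩ : TangentBundle 𝓘(ℝ, E) M)) p := X.mdifferentiableAt

lemma contMDiff_mvfderiv_apply (f : SmoothFun E M) (X : SmoothField E M) :
    ContMDiff 𝓘(ℝ, E) 𝓘(ℝ, ℝ) ∞ fun p ↦ mvfderiv 𝓘(ℝ, E) f p (X p) := by
  have h := (f.contMDiff.contMDiff_tangentMap (m := ∞) (by simp)).comp X.contMDiff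
  exact (contMDiff_snd_tangentBundle_modelSpace ℝ 𝓘(ℝ, ℝ)).comp h

lemma contMDiff_nabla {nabla : CovariantDerivative 𝓘(ℝ, E) E (fun p : M ↦ TangentSpace 𝓘(ℝ, E) p)}
    (hs : CovariantDerivative.ContMDiffCovariantDerivative nabla ∞)
    (X Y : SmoothField E M) :
    ContMDiff 𝓘(ℝ, E) 𝓘(ℝ, E).tangent ∞
      fun p ↦ (⟨p, nabla Y p (X p)⟩ : TangentBundle 𝓘(ℝ, E) M) := by
  have h := hs.contMDiff.contMDiff (σ := fun p ↦ Y p) (Y.contMDiff.contMDiffOn)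
  exact ContMDiff.clm_bundle_apply (contMDiffOn_univ.1 h) X.contMDiff

variable [FiniteDimensional ℝ E]

lemma isManifold_minSmoothness {k : ℕ∞} : IsManifold 𝓘(ℝ, E) (minSmoothness ℝ k) M := by
  rw [minSmoothness_of_isRCLikeNormedField]
  exact .of_le (n := ∞) (by exact_mod_cast le_top)

lemma contMDiff_mlieBracket (X Y : SmoothField E M) :
    ContMDiff 𝓘(ℝ, E) 𝓘(ℝ, E).tangent ∞ fun p ↦
      (⟨p, VectorField.mlieBracket 𝓘(ℝ, E) X Y p⟩ : TangentBundle 𝓘(ℝ, E) M) := fun p ↦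
  haveI : IsManifold 𝓘(ℝ, E) (minSmoothness ℝ 2) M := isManifold_minSmoothness (k := 2)
  haveI : IsManifold 𝓘(ℝ, E) (((⊤ : ℕ∞) : ℕ∞ω) + 1) M := ‹IsManifold 𝓘(ℝ, E) ∞ M›
  ContMDiffAt.mlieBracket_vectorField (m := ⊤) (n := ⊤) (X.contMDiff p) (Y.contMDiff p)
    (by simp)

variable [T2Space M]

/-- The derivative of a smooth function along a smooth vector field. -/
def SmoothField.deriv (X : SmoothField E M) (f : SmoothFun E M) : SmoothFun E M :=
  ⟨fun p ↦ mvfderiv 𝓘(ℝ, E) f p (X p), contMDiff_mvfderiv_apply f X⟩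

/-- The Lie bracket of smooth vector fields. -/
def SmoothField.bracket (X Y : SmoothField E M) : SmoothField E M :=
  ⟨fun p ↦ VectorField.mlieBracket 𝓘(ℝ, E) X Y p, contMDiff_mlieBracket X Y⟩

namespace SmoothField

lemma deriv_apply (X : SmoothField E M) (f : SmoothFun E M) (p : M) :
    X.deriv f p = mvfderiv 𝓘(ℝ, E) f p (X p) := rfl

lemma deriv_mul (X : SmoothField E M) (f h : SmoothFun E M) :
    X.deriv (f * h) = X.deriv f * h + f * X.deriv h := by
  ext p
  have := mvfderiv_mul (f.mdiffAt p) (h.mdiffAt p)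
  simp only [deriv_apply, ContMDiffMap.coe_mul, ContMDiffMap.coe_add, Pi.add_apply, Pi.mul_apply,
    this]
  simp; ring

lemma bracket_swap (X Y : SmoothField E M) : X.bracket Y = -Y.bracket X := by
  ext p
  exact VectorField.mlieBracket_swap_apply

lemma bracket_add (X Y Z : SmoothField E M) : X.bracket (Y + Z) = X.bracket Y + X.bracket Z := by
  ext p
  exact VectorField.mlieBracket_add_right (Y.mdiffAt p) (Z.mdiffAt p)

lemma bracket_smul (X : SmoothField E M) (f : SmoothFun E M) (Y : SmoothField E M) :
    X.bracket (f • Y) = X.deriv f • Y + f • X.bracket Y := by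
  ext p
  exact VectorField.mlieBracket_smul_right (f.mdiffAt p) (Y.mdiffAt p)

lemma bracket_jacobi (X Y Z : SmoothField E M) :
    X.bracket (Y.bracket Z) = (X.bracket Y).bracket Z + Y.bracket (X.bracket Z) := by
  have : IsManifold 𝓘(ℝ, E) (minSmoothness ℝ 3) M := isManifold_minSmoothness (k := 3)
  have h (X : SmoothField E M) : ContMDiff 𝓘(ℝ, E) 𝓘(ℝ, E).tangent (minSmoothness ℝ 2)
      fun q ↦ (⟨q, X q⟩ : TangentBundle 𝓘(ℝ, E) M) := X.contMDiff.of_le (by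
        rw [minSmoothness_of_isRCLikeNormedField]; exact ENat.LEInfty.out)
  ext p
  exact congrFun (VectorField.leibniz_identity_mlieBracket (h X) (h Y) (h Z)) p

lemma deriv_add (X : SmoothField E M) (f h : SmoothFun E M) :
    X.deriv (f + h) = X.deriv f + X.deriv h := by
  ext p
  have := mvfderiv_add (f.mdiffAt p) (h.mdiffAt p)
  simp only [deriv_apply, ContMDiffMap.coe_add, Pi.add_apply, this]
  rfl

/-- Expand the Jacobi identity on X, Y and fZ by the Leibniz rule: what remains is the claim times
Z. A field Z not vanishing at p then gives the claim, unless the tangent space is zero. -/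
lemma deriv_bracket (X Y : SmoothField E M) (f : SmoothFun E M) :
    (X.bracket Y).deriv f = X.deriv (Y.deriv f) - Y.deriv (X.deriv f) := by
  ext p
  by_cases h : ∃ w : TangentSpace 𝓘(ℝ, E) p, w ≠ 0
  · obtain ⟨w, hw⟩ := h
    obtain ⟨Z, hZ, -⟩ := exists_smoothField p w
    have h1 := bracket_jacobi X Y (f • Z)
    simp only [bracket_smul, bracket_add] at h1
    rw [bracket_jacobi X Y Z] at h1
    have h2 : ((X.bracket Y).deriv f - (X.deriv (Y.deriv f) - Y.deriv (X.deriv f))) • Z = 0 := by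
      rw [smul_add] at h1
      linear_combination (norm := module) -h1
    have h3 := congrArg (fun W : SmoothField E M ↦ W p) h2
    simp only [smul_apply, zero_apply, hZ] at h3
    have h4 := (smul_eq_zero.1 h3).resolve_right hw
    exact sub_eq_zero.1 h4
  · push Not at h
    have e (X : SmoothField E M) (f : SmoothFun E M) : X.deriv f p = 0 := by
      rw [deriv_apply, h (X p), map_zero]
    change (X.bracket Y).deriv f p = X.deriv (Y.deriv f) p - Y.deriv (X.deriv f) p
    rw [e, e, e, sub_zero]

end SmoothField

variable (E M) in
/-- The calculus of smooth vector fields on a manifold. -/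
def fieldCalculus : FieldCalculus (SmoothFun E M) (SmoothField E M) where
  act :=
    { toFun := fun X ↦ AddMonoidHom.mk' X.deriv X.deriv_add
      map_add' := fun X Y ↦ by ext f p; exact map_add (mvfderiv 𝓘(ℝ, E) f p) (X p) (Y p)
      map_smul' := fun a X ↦ by ext f p; exact map_smul (mvfderiv 𝓘(ℝ, E) f p) (a p) (X p) }
  br := AddMonoidHom.mk' (fun X ↦ AddMonoidHom.mk' X.bracket X.bracket_add) fun X Y ↦ by
    refine AddMonoidHom.ext fun Z ↦ ?_
    change (X + Y).bracket Z = X.bracket Z + Y.bracket Z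
    rw [SmoothField.bracket_swap, SmoothField.bracket_add, SmoothField.bracket_swap X,
      SmoothField.bracket_swap Y, neg_add]
  act_mul := SmoothField.deriv_mul
  br_smul := SmoothField.bracket_smul
  br_swap := SmoothField.bracket_swap
  jacobi := SmoothField.bracket_jacobi
  act_br := SmoothField.deriv_bracket

lemma fieldCalculus_act (X : SmoothField E M) (f : SmoothFun E M) (p : M) :
    (fieldCalculus E M).act X f p = mvfderiv 𝓘(ℝ, E) f p (X p) := rfl

section Connection

variable {nabla : CovariantDerivative 𝓘(ℝ, E) E (fun p : M ↦ TangentSpace 𝓘(ℝ, E) p)}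

/-- The connection on smooth vector fields given by a smooth torsion free covariant derivative. -/
def connection (hs : CovariantDerivative.ContMDiffCovariantDerivative nabla ∞)
    (ht : nabla.torsion = 0) : FieldCalculus.Connection (fieldCalculus E M) where
  nab :=
    { toFun := fun X ↦ AddMonoidHom.mk' (fun Y ↦ ⟨fun p ↦ nabla Y p (X p), contMDiff_nabla hs X Y⟩)
        fun Y Z ↦ by
          ext p
          exact congrArg (fun L ↦ L (X p))
            (nabla.isCovariantDerivativeOnUniv.add (Y.mdiffAt p) (Z.mdiffAt p))
      map_add' := fun X X' ↦ by
        ext Y p; exact map_add (nabla Y p) (X p) (X' p)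
      map_smul' := fun a X ↦ by
        ext Y p; exact map_smul (nabla Y p) (a p) (X p) }
  leibniz X f Y := by
    ext p
    have h := congrArg (fun L ↦ L (X p))
      (nabla.isCovariantDerivativeOnUniv.leibniz (Y.mdiffAt p) (f.mdiffAt p))
    refine h.trans ?_
    exact add_comm _ _
  torsion_free X Y := by
    ext p
    exact (nabla.torsion_eq_zero_iff.1 ht (X.mdiffAt p) (Y.mdiffAt p)).symm

variable (hs : CovariantDerivative.ContMDiffCovariantDerivative nabla ∞) (ht : nabla.torsion = 0)

lemma connection_nab (X Y : SmoothField E M) (p : M) :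
    (connection hs ht).nab X Y p = nabla Y p (X p) := rfl

lemma connection_curv (X Y Z : SmoothField E M) (p : M) :
    (connection hs ht).curv X Y Z p = curvature nabla X Y Z p := rfl

end Connection

end

/-! ### From function-linear operators to tensors at a point: curvature, traces and the Ricci
tensor. -/

noncomputable section

open Filter Topology

set_option linter.unusedSectionVars false

variable {E : Type*} [NormedAddCommGroup E] [NormedSpace ℝ E] [FiniteDimensional ℝ E]
  {M : Type*} [TopologicalSpace M] [T2Space M] [ChartedSpace E M] [IsManifold 𝓘(ℝ, E) ∞ M]

instance (p : M) : FiniteDimensional ℝ (TangentSpace 𝓘(ℝ, E) p) :=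
  inferInstanceAs (FiniteDimensional ℝ E)

lemma finrank_tangentSpace (p : M) :
    Module.finrank ℝ (TangentSpace 𝓘(ℝ, E) p) = Module.finrank ℝ E := rfl

namespace FrameAt

variable {p : M} (F : FrameAt (E := E) p)

/-- The one-forms of the frame, acting on smooth vector fields. -/
def form (i : Fin (Module.finrank ℝ E)) : SmoothField E M →ₗ[SmoothFun E M] SmoothFun E M where
  toFun X := ⟨fun q ↦ F.θ i q (X q), F.smooth i X⟩
  map_add' X Y := by ext q; exact map_add (F.θ i q) (X q) (Y q)
  map_smul' a X := by ext q; exact map_smul (F.θ i q) (a q) (X q)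

lemma form_apply (i : Fin (Module.finrank ℝ E)) (X : SmoothField E M) (q : M) :
    F.form i X q = F.θ i q (X q) := rfl

lemma smul_eq_sum (X : SmoothField E M) : F.χ • X = ∑ i, F.form i X • F.e i := by
  ext q
  rw [SmoothField.sum_apply]
  exact F.dual q (X q)

lemma χ_self : F.χ p = 1 := F.χ_one.self_of_nhds

lemma map_apply (L : SmoothField E M →ₗ[SmoothFun E M] SmoothField E M) (X : SmoothField E M) :
    L X p = ∑ i, F.θ i p (X p) • L (F.e i) p := by
  have h := congrArg (fun Y : SmoothField E M ↦ L Y p) (F.smul_eq_sum X)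
  simp only [map_smul, map_sum, SmoothField.smul_apply, SmoothField.sum_apply, F.χ_self, one_smul,
    form_apply] at h
  exact h

lemma trace_eq {q : M} (hq : F.χ q = 1)
    (T : TangentSpace 𝓘(ℝ, E) q →ₗ[ℝ] TangentSpace 𝓘(ℝ, E) q) :
    LinearMap.trace ℝ _ T = ∑ i, F.θ i q (T (F.e i q)) := by
  have h : T = ∑ i, (F.θ i q).smulRight (T (F.e i q)) := by
    ext w
    have := congrArg T (F.dual q w)
    rw [hq, one_smul, map_sum] at this
    simp only [map_smul] at this
    simpa using this
  conv_lhs => rw [h]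
  simp [map_sum]

end FrameAt

/-- In a frame at p with χ(p) = 1, function-linearity makes the value of LX at p depend only on the
components of X at p. -/
lemma tensorial {L : SmoothField E M →ₗ[SmoothFun E M] SmoothField E M} {X Y : SmoothField E M}
    {p : M} (h : X p = Y p) : L X p = L Y p := by
  obtain ⟨F⟩ := exists_frameAt (E := E) p
  rw [F.map_apply, F.map_apply, h]

section Curvature

variable {nabla : CovariantDerivative 𝓘(ℝ, E) E (fun p : M ↦ TangentSpace 𝓘(ℝ, E) p)}
  (hs : CovariantDerivative.ContMDiffCovariantDerivative nabla ∞) (ht : nabla.torsion = 0)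

include hs ht in
lemma curv_congr {X X' Y Y' Z Z' : SmoothField E M} {p : M} (hX : X p = X' p) (hY : Y p = Y' p)
    (hZ : Z p = Z' p) :
    (connection hs ht).curv X Y Z p = (connection hs ht).curv X' Y' Z' p := by
  trans (connection hs ht).curv X' Y Z p
  · exact tensorial (L := ((connection hs ht).curvₗ.flip Y).flip Z) hX
  trans (connection hs ht).curv X' Y' Z p
  · exact tensorial (L := ((connection hs ht).curvₗ X').flip Z) hY
  · exact tensorial (L := (connection hs ht).curvₗ X' Y') hZ

lemma mdiffAt_of_eventuallyEq {X : SmoothField E M} {Y : Π q : M, TangentSpace 𝓘(ℝ, E) q} {p : M}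
    (h : ∀ᶠ q in 𝓝 p, Y q = X q) : MDifferentiableAt 𝓘(ℝ, E) 𝓘(ℝ, E).tangent
      (fun q ↦ (⟨q, Y q⟩ : TangentBundle 𝓘(ℝ, E) M)) p := by
  refine (X.mdiffAt p).congr_of_eventuallyEq ?_
  filter_upwards [h] with q hq
  rw [hq]

lemma nabla_congr {X : SmoothField E M} {Y : Π q : M, TangentSpace 𝓘(ℝ, E) q} {p : M}
    (h : ∀ᶠ q in 𝓝 p, Y q = X q) : nabla Y p = nabla X p :=
  nabla.isCovariantDerivativeOnUniv.congr_of_eventuallyEq (mdiffAt_of_eventuallyEq h)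
    (X.mdiffAt p) univ_mem h

include hs ht in
-- The standard extensions of tangent vectors are smooth only near p; as curvature depends on germs,
-- they can be replaced by global smooth fields.
lemma curvature_congr {X Y Z : SmoothField E M} {X' Y' Z' : Π q : M, TangentSpace 𝓘(ℝ, E) q}
    {p : M} (hX : ∀ᶠ q in 𝓝 p, X' q = X q) (hY : ∀ᶠ q in 𝓝 p, Y' q = Y q)
    (hZ : ∀ᶠ q in 𝓝 p, Z' q = Z q) :
    curvature nabla X' Y' Z' p = (connection hs ht).curv X Y Z p := by
  rw [connection_curv]
  have h {W : SmoothField E M} {W' : Π q : M, TangentSpace 𝓘(ℝ, E) q}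
      (hW : ∀ᶠ q in 𝓝 p, W' q = W q) :
      ∀ᶠ q in 𝓝 p, nabla Z' q (W' q) = (connection hs ht).nab W Z q := by
    filter_upwards [hW, hZ.eventually_nhds] with q h1 h2
    rw [connection_nab, nabla_congr h2, h1]
  have b : VectorField.mlieBracket 𝓘(ℝ, E) X' Y' p = VectorField.mlieBracket 𝓘(ℝ, E) X Y p :=
    Filter.EventuallyEq.mlieBracket_vectorField_eq hX hY
  rw [curvature, nabla_congr (h hX), nabla_congr (h hY), nabla_congr hZ, hX.self_of_nhds,
    hY.self_of_nhds, b]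
  rfl

include hs ht in
lemma curvatureAt_eq (X Y Z : SmoothField E M) (p : M) :
    curvatureAt nabla p (X p) (Y p) (Z p) = (connection hs ht).curv X Y Z p := by
  obtain ⟨X', hX, hX'⟩ := exists_smoothField p (X p)
  obtain ⟨Y', hY, hY'⟩ := exists_smoothField p (Y p)
  obtain ⟨Z', hZ, hZ'⟩ := exists_smoothField p (Z p)
  rw [curvatureAt, curvature_congr hs ht (hX'.mono fun _ h ↦ h.symm)
    (hY'.mono fun _ h ↦ h.symm) (hZ'.mono fun _ h ↦ h.symm)]
  exact curv_congr hs ht hX hY hZ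

/-- The endomorphism `x ↦ R(x, y)z` of the tangent space. -/
def curvatureEnd (p : M) (y z : TangentSpace 𝓘(ℝ, E) p) :
    TangentSpace 𝓘(ℝ, E) p →ₗ[ℝ] TangentSpace 𝓘(ℝ, E) p where
  toFun x := curvatureAt nabla p x y z
  map_add' x x' := by
    obtain ⟨X, rfl, -⟩ := exists_smoothField p x
    obtain ⟨X', rfl, -⟩ := exists_smoothField p x'
    obtain ⟨Y, rfl, -⟩ := exists_smoothField p y
    obtain ⟨Z, rfl, -⟩ := exists_smoothField p z
    rw [← SmoothField.add_apply, curvatureAt_eq hs ht, curvatureAt_eq hs ht, curvatureAt_eq hs ht,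
      FieldCalculus.Connection.curv_add₁]
    rfl
  map_smul' a x := by
    obtain ⟨X, rfl, -⟩ := exists_smoothField p x
    obtain ⟨Y, rfl, -⟩ := exists_smoothField p y
    obtain ⟨Z, rfl, -⟩ := exists_smoothField p z
    have h : a • X p = ((algebraMap ℝ (SmoothFun E M) a) • X) p := rfl
    rw [h, curvatureAt_eq hs ht, curvatureAt_eq hs ht, FieldCalculus.Connection.curv_smul₁]
    rfl

lemma curvatureEnd_apply (p : M) (x y z : TangentSpace 𝓘(ℝ, E) p) :
    curvatureEnd hs ht p y z x = curvatureAt nabla p x y z := rfl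

lemma ricci_eq_trace (p : M) (y z : TangentSpace 𝓘(ℝ, E) p) :
    ricci nabla p y z = LinearMap.trace ℝ _ (curvatureEnd hs ht p y z) := by
  rw [LinearMap.trace_eq_matrix_trace ℝ (tangentBasis p)]
  simp [ricci, Matrix.trace, LinearMap.toMatrix_apply, curvatureEnd_apply]

end Curvature

lemma SmoothFun.two_apply (p : M) : (2 : SmoothFun E M) p = 2 := by
  rw [← one_add_one_eq_two, ← one_add_one_eq_two]; rfl

lemma SmoothFun.two_mul_apply (a : SmoothFun E M) (p : M) : (2 * a) p = 2 * a p := by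
  rw [two_mul, two_mul]; rfl

namespace RiemannianPiStructure

variable (S : RiemannianPiStructure E M)

lemma contMDiff_metric (X Y : SmoothField E M) :
    ContMDiff 𝓘(ℝ, E) 𝓘(ℝ, ℝ) ∞ fun p ↦ S.metric p (X p) (Y p) := by
  have h : ContMDiff 𝓘(ℝ, E) (𝓘(ℝ, E).prod 𝓘(ℝ, ℝ)) ∞ fun p ↦
      Bundle.TotalSpace.mk' ℝ (E := Bundle.Trivial M ℝ) p (S.g.inner p (X p) (Y p)) :=
    ContMDiff.clm_bundle_apply₂ (b := fun p : M ↦ p) S.g.contMDiff X.contMDiff Y.contMDiff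
  intro p
  have := h p
  simp only [Bundle.contMDiffAt_totalSpace] at this
  exact this.2

lemma contMDiff_η (X : SmoothField E M) :
    ContMDiff 𝓘(ℝ, E) 𝓘(ℝ, ℝ) ∞ fun p ↦ S.η p (X p) := by
  have h : ContMDiff 𝓘(ℝ, E) (𝓘(ℝ, E).prod 𝓘(ℝ, ℝ)) ∞ fun p ↦
      Bundle.TotalSpace.mk' ℝ (E := Bundle.Trivial M ℝ) p (S.η p (X p)) :=
    ContMDiff.clm_bundle_apply (b := fun p : M ↦ p) S.η_smooth X.contMDiff
  intro p
  have := h p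
  simp only [Bundle.contMDiffAt_totalSpace] at this
  exact this.2

lemma contMDiff_φ (X : SmoothField E M) :
    ContMDiff 𝓘(ℝ, E) 𝓘(ℝ, E).tangent ∞
      fun p ↦ (⟨p, S.φ p (X p)⟩ : TangentBundle 𝓘(ℝ, E) M) :=
  ContMDiff.clm_bundle_apply (b := fun p : M ↦ p) S.φ_smooth X.contMDiff

/-- The metric on smooth vector fields. -/
def gₗ : SmoothField E M →ₗ[SmoothFun E M] SmoothField E M →ₗ[SmoothFun E M] SmoothFun E M :=
  LinearMap.mk₂ _ (fun X Y ↦ ⟨fun p ↦ S.metric p (X p) (Y p), S.contMDiff_metric X Y⟩)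
    (fun X X' Y ↦ by
      ext p; exact congrArg (fun L ↦ L (Y p)) (map_add (S.g.inner p) (X p) (X' p)))
    (fun a X Y ↦ by
      ext p; exact congrArg (fun L ↦ L (Y p)) (map_smul (S.g.inner p) (a p) (X p)))
    (fun X Y Y' ↦ by ext p; exact map_add (S.g.inner p (X p)) (Y p) (Y' p))
    (fun a X Y ↦ by ext p; exact map_smul (S.g.inner p (X p)) (a p) (Y p))

/-- The one-form `η` on smooth vector fields. -/
def ηₗ : SmoothField E M →ₗ[SmoothFun E M] SmoothFun E M where
  toFun X := ⟨fun p ↦ S.η p (X p), S.contMDiff_η X⟩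
  map_add' X Y := by ext p; exact map_add (S.η p) (X p) (Y p)
  map_smul' a X := by ext p; exact map_smul (S.η p) (a p) (X p)

/-- The tensor `φ` on smooth vector fields. -/
def φₗ : SmoothField E M →ₗ[SmoothFun E M] SmoothField E M where
  toFun X := ⟨fun p ↦ S.φ p (X p), S.contMDiff_φ X⟩
  map_add' X Y := by ext p; exact map_add (S.φ p) (X p) (Y p)
  map_smul' a X := by ext p; exact map_smul (S.φ p) (a p) (X p)

/-- The vector field `ξ`, bundled. -/
def ξₛ : SmoothField E M := ⟨S.ξ, S.ξ_smooth⟩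

lemma φₗ_apply (X : SmoothField E M) (p : M) : S.φₗ X p = S.φ p (X p) := rfl

lemma ξₛ_apply (p : M) : S.ξₛ p = S.ξ p := rfl

section Pointwise

variable (p : M) (x y : TangentSpace 𝓘(ℝ, E) p)

lemma metric_symm : S.metric p x y = S.metric p y x := S.g.symm p x y

lemma metric_ξ : S.metric p x (S.ξ p) = S.η p x := by
  have h := S.g_φ p x (S.ξ p)
  rw [S.φ_ξ, map_zero, S.η_ξ, mul_one] at h
  exact (sub_eq_zero.1 h.symm)

lemma metric_φ : S.metric p (S.φ p x) y = S.metric p x (S.φ p y) := by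
  have h := S.g_φ p x (S.φ p y)
  have h2 : S.metric p (S.φ p x) (S.ξ p) = 0 := by rw [S.metric_ξ, S.η_φ]
  rw [S.φ_sq, map_sub, map_smul, S.η_φ, mul_zero, sub_zero, smul_eq_mul] at h
  change S.metric p (S.φ p x) y - S.η p y * S.metric p (S.φ p x) (S.ξ p) = _ at h
  rw [h2, mul_zero, sub_zero] at h
  exact h

lemma eq_zero_of_metric (h : ∀ z, S.metric p x z = 0) : x = 0 := by
  by_contra hx
  exact (S.g.pos p x hx).ne' (h x)

end Pointwise

section ParaSasaki

variable {S} {nabla : CovariantDerivative 𝓘(ℝ, E) E (fun p : M ↦ TangentSpace 𝓘(ℝ, E) p)}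
  (hn : IsLeviCivita S.metric nabla) (hS : S.IsParaSasakiLike nabla)

/-- The algebraic para-Sasaki-like structure on smooth vector fields. -/
def toParaSasaki : FieldCalculus.ParaSasaki (connection hn.smooth hn.torsion_free) where
  g := S.gₗ
  φ := S.φₗ
  ξ := S.ξₛ
  η := S.ηₗ
  metric :=
    { symm := fun X Y ↦ by ext p; exact S.metric_symm p _ _
      compat := fun X Y Z ↦ by
        ext p
        exact hn.metric p Y Z (Y.mdiffAt p) (Z.mdiffAt p) (X p) }
  φ_ξ := by ext p; exact S.φ_ξ p
  φ_sq X := by ext p; exact S.φ_sq p (X p)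
  η_φ X := by ext p; exact S.η_φ p (X p)
  η_ξ := by ext p; exact S.η_ξ p
  g_ξ X := by ext p; exact S.metric_ξ p (X p)
  g_φ X Y := by ext p; exact S.metric_φ p (X p) (Y p)
  nab_φ X Y := by
    ext p
    have h := hS Y Y.isSmoothField p (X p)
    rw [mul_assoc, ← smul_smul, two_smul]
    change nabla (fun q ↦ S.φ q (Y q)) p (X p) = S.φ p (nabla Y p (X p))
      - S.metric p (X p) (Y p) • S.ξ p - S.η p (Y p) • X p
      + ((S.η p (X p) * S.η p (Y p)) • S.ξ p + (S.η p (X p) * S.η p (Y p)) • S.ξ p)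
    rw [mul_assoc, ← smul_smul, two_smul] at h
    rw [← sub_eq_zero, ← sub_eq_zero.2 h]
    abel
  two a h := by
    ext p
    have := congrArg (fun f : SmoothFun E M ↦ f p) h
    simpa [SmoothFun.two_mul_apply] using this
  nondeg X h := by
    ext p
    refine S.eq_zero_of_metric p (X p) fun z ↦ ?_
    obtain ⟨Z, rfl, -⟩ := exists_smoothField p z
    exact congrArg (fun f : SmoothFun E M ↦ f p) (h Z)

end ParaSasaki

end RiemannianPiStructure

/-- A derivation formula for the trace `∑ θᵢ(T eᵢ)` of a tensor with respect to dual frames. -/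
lemma FieldCalculus.lie_trace {A V ι : Type*} [CommRing A] [AddCommGroup V] [Module A V]
    [Fintype ι] (C : FieldCalculus A V) {χ : A} {e : ι → V} {θ : ι → V →ₗ[A] A}
    (h : ∀ X, χ • X = ∑ i, θ i X • e i) (ξ : V) {T T' : V →ₗ[A] V}
    (hT : ∀ X, C.br ξ (T X) = T (C.br ξ X) + T' X) :
    χ * C.act ξ (∑ i, θ i (T (e i))) = C.act ξ χ * ∑ i, θ i (T (e i))
      + χ * ∑ i, θ i (T' (e i)) := by
  -- The Lie derivatives of the coframe.
  set L : ι → V →ₗ[A] A := fun i ↦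
    { toFun := fun X ↦ C.act ξ (θ i X) - θ i (C.br ξ X)
      map_add' := fun X Y ↦ by simp only [map_add]; ring
      map_smul' := fun a X ↦ by
        simp only [map_smul, map_add, smul_eq_mul, C.act_mul, C.br_smul, RingHom.id_apply]; ring }
    with hL
  have L_apply (i : ι) (X : V) : C.act ξ (θ i X) = L i X + θ i (C.br ξ X) := by simp [hL]
  -- The Lie derivative of the duality relation: the variations of frame and coframe cancel up to
  -- the derivative of χ.
  have K (X : V) : ∑ i, (L i X • e i + θ i X • C.br ξ (e i)) = C.act ξ χ • X := by
    have h1 := congrArg (C.br ξ) (h X)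
    simp only [map_sum, C.br_smul, L_apply, h (C.br ξ X)] at h1
    rw [← eq_sub_iff_add_eq] at h1
    rw [h1, ← Finset.sum_sub_distrib]
    refine Finset.sum_congr rfl fun i _ ↦ ?_
    module
  have expand (ℓ : V →ₗ[A] A) (X : V) : χ * ℓ X = ∑ j, θ j X * ℓ (e j) := by
    have := congrArg ℓ (h X)
    simpa using this
  have key : ∑ i, (χ * L i (T (e i)) + χ * θ i (T (C.br ξ (e i))))
      = C.act ξ χ * ∑ j, θ j (T (e j)) := by
    have h2 (j : ι) : ∑ i, (L i (e j) * θ j (T (e i)) + θ i (e j) * θ j (T (C.br ξ (e i))))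
        = C.act ξ χ * θ j (T (e j)) := by
      have := congrArg (fun X ↦ θ j (T X)) (K (e j))
      simpa using this
    rw [Finset.mul_sum, ← Finset.sum_congr rfl fun j _ ↦ h2 j, Finset.sum_comm]
    refine Finset.sum_congr rfl fun i _ ↦ ?_
    rw [expand, expand, ← Finset.sum_add_distrib]
    exact Finset.sum_congr rfl fun j _ ↦ by ring
  rw [← key, map_sum, Finset.mul_sum, Finset.mul_sum, ← Finset.sum_add_distrib]
  refine Finset.sum_congr rfl fun i _ ↦ ?_
  rw [L_apply, hT, map_add]; ring

/-- Adjoint endomorphisms with respect to a nondegenerate symmetric form have the same trace. -/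
lemma trace_eq_of_adjoint {V : Type*} [AddCommGroup V] [Module ℝ V] [FiniteDimensional ℝ V]
    (B : V →ₗ[ℝ] V →ₗ[ℝ] ℝ) (hB : ∀ x y, B x y = B y x) (hnd : ∀ x, (∀ z, B x z = 0) → x = 0)
    {T U : V →ₗ[ℝ] V} (h : ∀ x w, B (T x) w = B x (U w)) :
    LinearMap.trace ℝ V T = LinearMap.trace ℝ V U := by
  have hi : Function.Injective B := (injective_iff_map_eq_zero B).2 fun x hx ↦
    hnd x fun z ↦ by rw [hx]; rfl
  let e : V ≃ₗ[ℝ] Module.Dual ℝ V :=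
    LinearEquiv.ofInjectiveOfFinrankEq B hi Subspace.dual_finrank_eq.symm
  have he (x : V) : e x = B x := rfl
  -- The isomorphism of V with its dual given by B conjugates U into the transpose of T.
  rw [← LinearMap.trace_transpose' T, ← LinearMap.trace_conj' U e]
  congr 1
  ext f x
  obtain ⟨w, rfl⟩ := e.surjective f
  simp only [LinearEquiv.conj_apply, LinearMap.comp_apply, LinearEquiv.coe_coe,
    LinearEquiv.symm_apply_apply, Module.Dual.transpose_apply]
  rw [he, he, hB, h, hB]

lemma SmoothFun.sum_apply {ι : Type*} (s : Finset ι) (f : ι → SmoothFun E M) (p : M) :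
    (∑ i ∈ s, f i) p = ∑ i ∈ s, f i p :=
  map_sum (⟨⟨fun f ↦ f p, rfl⟩, fun _ _ ↦ rfl⟩ : SmoothFun E M →+ ℝ) f s

lemma mvfderiv_congr {f h : M → ℝ} {p : M} (e : f =ᶠ[𝓝 p] h) :
    mvfderiv 𝓘(ℝ, E) f p = mvfderiv 𝓘(ℝ, E) h p := by
  unfold mvfderiv
  rw [e.mfderiv_eq, e.self_of_nhds]

section Ricci

variable {nabla : CovariantDerivative 𝓘(ℝ, E) E (fun p : M ↦ TangentSpace 𝓘(ℝ, E) p)}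
  (hs : CovariantDerivative.ContMDiffCovariantDerivative nabla ∞) (ht : nabla.torsion = 0)

include hs ht in
lemma ricci_eq_frame {p q : M} (F : FrameAt (E := E) p) (hq : F.χ q = 1) (Y Z : SmoothField E M) :
    ricci nabla q (Y q) (Z q) = (∑ i, F.form i ((connection hs ht).curv (F.e i) Y Z)) q := by
  rw [ricci_eq_trace hs ht, F.trace_eq hq, SmoothFun.sum_apply]
  refine Finset.sum_congr rfl fun i _ ↦ ?_
  rw [curvatureEnd_apply, curvatureAt_eq hs ht, F.form_apply]

include hs ht in
lemma contMDiff_ricci (Y Z : SmoothField E M) :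
    ContMDiff 𝓘(ℝ, E) 𝓘(ℝ, ℝ) ∞ fun p ↦ ricci nabla p (Y p) (Z p) := by
  intro p
  obtain ⟨F⟩ := exists_frameAt (E := E) p
  refine ((∑ i, F.form i ((connection hs ht).curv (F.e i) Y Z)).contMDiff p).congr_of_eventuallyEq
    ?_
  filter_upwards [F.χ_one] with q hq
  exact ricci_eq_frame hs ht F hq Y Z

/-- The Ricci tensor evaluated on smooth vector fields. -/
def ricciFun (Y Z : SmoothField E M) : SmoothFun E M :=
  ⟨fun p ↦ ricci nabla p (Y p) (Z p), contMDiff_ricci hs ht Y Z⟩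

include hs ht in
lemma ricci_smul_right (p : M) (a : ℝ) (y z : TangentSpace 𝓘(ℝ, E) p) :
    ricci nabla p y (a • z) = a * ricci nabla p y z := by
  rw [ricci_eq_trace hs ht, ricci_eq_trace hs ht, ← smul_eq_mul, ← map_smul]
  congr 1
  ext x
  obtain ⟨X, rfl, -⟩ := exists_smoothField p x
  obtain ⟨Y, rfl, -⟩ := exists_smoothField p y
  obtain ⟨Z, rfl, -⟩ := exists_smoothField p z
  have h : a • Z p = ((algebraMap ℝ (SmoothFun E M) a) • Z) p := rfl
  rw [LinearMap.smul_apply, curvatureEnd_apply, curvatureEnd_apply, h, curvatureAt_eq hs ht,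
    curvatureAt_eq hs ht, FieldCalculus.Connection.curv_smul₃]
  rfl

include hs ht in
lemma ricci_add_right (p : M) (y z z' : TangentSpace 𝓘(ℝ, E) p) :
    ricci nabla p y (z + z') = ricci nabla p y z + ricci nabla p y z' := by
  rw [ricci_eq_trace hs ht, ricci_eq_trace hs ht, ricci_eq_trace hs ht, ← map_add]
  congr 1
  ext x
  obtain ⟨X, rfl, -⟩ := exists_smoothField p x
  obtain ⟨Y, rfl, -⟩ := exists_smoothField p y
  obtain ⟨Z, rfl, -⟩ := exists_smoothField p z
  obtain ⟨Z', rfl, -⟩ := exists_smoothField p z'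
  rw [LinearMap.add_apply, curvatureEnd_apply, curvatureEnd_apply, curvatureEnd_apply,
    ← SmoothField.add_apply, curvatureAt_eq hs ht, curvatureAt_eq hs ht, curvatureAt_eq hs ht,
    FieldCalculus.Connection.curv_add₃]
  rfl

end Ricci

/-! ### The Ricci tensor of a para-Sasaki-like structure. -/

namespace RiemannianPiStructure

variable {S : RiemannianPiStructure E M}
  {nabla : CovariantDerivative 𝓘(ℝ, E) E (fun p : M ↦ TangentSpace 𝓘(ℝ, E) p)}
  (hn : IsLeviCivita S.metric nabla) (hS : S.IsParaSasakiLike nabla)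

variable (S) in
/-- The metric at a point as a bilinear form. -/
def bilin (p : M) :
    TangentSpace 𝓘(ℝ, E) p →ₗ[ℝ] TangentSpace 𝓘(ℝ, E) p →ₗ[ℝ] ℝ where
  toFun x := (S.g.inner p x).toLinearMap
  map_add' x y := by rw [map_add]; rfl
  map_smul' a x := by rw [map_smul]; rfl

variable (S) in
lemma bilin_apply (p : M) (x y : TangentSpace 𝓘(ℝ, E) p) : S.bilin p x y = S.metric p x y := rfl

variable (S) in
lemma trace_eq_of_adjoint (p : M)
    {T U : TangentSpace 𝓘(ℝ, E) p →ₗ[ℝ] TangentSpace 𝓘(ℝ, E) p}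
    (h : ∀ x w, S.metric p (T x) w = S.metric p x (U w)) :
    LinearMap.trace ℝ _ T = LinearMap.trace ℝ _ U :=
  PiGeometry.trace_eq_of_adjoint (S.bilin p) (S.metric_symm p) (S.eq_zero_of_metric p) h

section Curvature

variable (p : M) (x y z w : TangentSpace 𝓘(ℝ, E) p)

include hn hS in
lemma curvatureAt_ξ : curvatureAt nabla p x y (S.ξ p) = S.η p x • y - S.η p y • x := by
  obtain ⟨X, rfl, -⟩ := exists_smoothField p x
  obtain ⟨Y, rfl, -⟩ := exists_smoothField p y
  rw [← S.ξₛ_apply, curvatureAt_eq hn.smooth hn.torsion_free]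
  exact congrArg (fun W : SmoothField E M ↦ W p) ((toParaSasaki hn hS).curv_ξ X Y)

include hn hS in
lemma curvatureAt_φ : curvatureAt nabla p x y (S.φ p z) = S.φ p (curvatureAt nabla p x y z)
    - S.metric p y z • S.φ p x + S.metric p x z • S.φ p y - S.metric p x (S.φ p z) • y
    + S.metric p y (S.φ p z) • x
    + (2 * (S.η p y * S.metric p x (S.φ p z) - S.η p x * S.metric p y (S.φ p z))) • S.ξ p
    + (2 * S.η p z) • (S.η p y • S.φ p x - S.η p x • S.φ p y) := by
  obtain ⟨X, rfl, -⟩ := exists_smoothField p x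
  obtain ⟨Y, rfl, -⟩ := exists_smoothField p y
  obtain ⟨Z, rfl, -⟩ := exists_smoothField p z
  have h := congrArg (fun W : SmoothField E M ↦ W p) ((toParaSasaki hn hS).curv_φ X Y Z)
  simp only [SmoothField.add_apply, SmoothField.smul_apply, SmoothField.sub_apply,
    SmoothFun.two_mul_apply] at h
  rw [← S.φₗ_apply Z, curvatureAt_eq hn.smooth hn.torsion_free,
    curvatureAt_eq hn.smooth hn.torsion_free]
  exact h

-- The form of pair symmetry needed for traces: R(·, y)z and R(·, z)y are adjoint, which makes ρ
-- symmetric.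
include hn hS in
lemma metric_curvatureAt : S.metric p (curvatureAt nabla p x y z) w
    = S.metric p x (curvatureAt nabla p w z y) := by
  obtain ⟨X, rfl, -⟩ := exists_smoothField p x
  obtain ⟨Y, rfl, -⟩ := exists_smoothField p y
  obtain ⟨Z, rfl, -⟩ := exists_smoothField p z
  obtain ⟨W, rfl, -⟩ := exists_smoothField p w
  rw [curvatureAt_eq hn.smooth hn.torsion_free, curvatureAt_eq hn.smooth hn.torsion_free]
  have P := toParaSasaki hn hS
  set D := connection hn.smooth hn.torsion_free
  have hm : D.IsMetric S.gₗ := (toParaSasaki hn hS).metric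
  have h : S.gₗ (D.curv X Y Z) W = S.gₗ X (D.curv W Z Y) := by
    rw [hm.curv_pair (fun a h ↦ P.two a h), D.curv_swap Z W, map_neg, LinearMap.neg_apply,
      hm.curv_skew, neg_neg]
  exact congrArg (fun f : SmoothFun E M ↦ f p) h

end Curvature

section Ricci

variable (p : M) (x y z : TangentSpace 𝓘(ℝ, E) p)

include hn hS in
lemma ricci_symm : ricci nabla p y z = ricci nabla p z y := by
  rw [ricci_eq_trace hn.smooth hn.torsion_free, ricci_eq_trace hn.smooth hn.torsion_free]
  exact S.trace_eq_of_adjoint p fun x w ↦ metric_curvatureAt hn hS p x y z w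

include hn hS in
lemma ricci_ξ {n : ℕ} (hE : Module.finrank ℝ E = 2 * n + 1) :
    ricci nabla p y (S.ξ p) = -(2 * n : ℝ) * S.η p y := by
  have h : curvatureEnd hn.smooth hn.torsion_free p y (S.ξ p)
      = (S.η p).toLinearMap.smulRight y - S.η p y • LinearMap.id := by
    ext x
    exact curvatureAt_ξ hn hS p x y
  rw [ricci_eq_trace hn.smooth hn.torsion_free, h, map_sub, map_smul, LinearMap.trace_id,
    LinearMap.trace_smulRight, finrank_tangentSpace, hE]
  push_cast
  simp only [smul_eq_mul]
  ring

include hn hS in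
lemma ricci_φ_eq_trace {n : ℕ} (hE : Module.finrank ℝ E = 2 * n + 1) :
    ricci nabla p y (S.φ p z) = LinearMap.trace ℝ _
      ((S.φ p).toLinearMap ∘ₗ curvatureEnd hn.smooth hn.torsion_free p y z)
      + (2 * n - 1) * S.metric p y (S.φ p z) := by
  have h : curvatureEnd hn.smooth hn.torsion_free p y (S.φ p z)
      = (S.φ p).toLinearMap ∘ₗ curvatureEnd hn.smooth hn.torsion_free p y z
        + (2 * S.η p z * S.η p y - S.metric p y z) • (S.φ p).toLinearMap
        + (S.bilin p z).smulRight (S.φ p y) - (S.bilin p (S.φ p z)).smulRight y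
        + S.metric p y (S.φ p z) • LinearMap.id
        + (2 * S.η p y) • (S.bilin p (S.φ p z)).smulRight (S.ξ p)
        - (2 * S.metric p y (S.φ p z)) • (S.η p).toLinearMap.smulRight (S.ξ p)
        - (2 * S.η p z) • (S.η p).toLinearMap.smulRight (S.φ p y) := by
    ext x
    have e := curvatureAt_φ hn hS p x y z
    simp only [LinearMap.sub_apply, LinearMap.add_apply, LinearMap.smul_apply,
      LinearMap.smulRight_apply, LinearMap.comp_apply, LinearMap.id_apply, curvatureEnd_apply,
      bilin_apply, ContinuousLinearMap.coe_coe, S.metric_symm p _ x, e]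
    module
  rw [ricci_eq_trace hn.smooth hn.torsion_free, h]
  simp only [map_sub, map_add, map_smul, LinearMap.trace_smulRight, LinearMap.trace_id, S.trace_φ,
    bilin_apply, ContinuousLinearMap.coe_coe, S.η_φ, S.η_ξ, S.metric_ξ, finrank_tangentSpace, hE,
    smul_eq_mul]
  rw [S.metric_symm p z, S.metric_symm p (S.φ p z), S.metric_φ]
  push_cast
  ring

-- Tracing the Ricci identity reduces this to the trace of φ ∘ R(·, y)z; its adjoint is R(·, z)y ∘
-- φ, and the trace is cyclic.
include hn hS in
lemma ricci_φ_comm {n : ℕ} (hE : Module.finrank ℝ E = 2 * n + 1) :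
    ricci nabla p y (S.φ p z) = ricci nabla p (S.φ p y) z := by
  rw [ricci_symm hn hS p (S.φ p y), ricci_φ_eq_trace hn hS p y z hE,
    ricci_φ_eq_trace hn hS p z y hE, ← S.metric_φ, S.metric_symm p (S.φ p y)]
  congr 1
  trans LinearMap.trace ℝ _
    (curvatureEnd hn.smooth hn.torsion_free p z y ∘ₗ (S.φ p).toLinearMap)
  · refine S.trace_eq_of_adjoint p fun x w ↦ ?_
    refine (S.metric_φ p _ w).trans ?_
    exact metric_curvatureAt hn hS p x y z (S.φ p w)
  · exact LinearMap.trace_comp_comm' _ _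

include hn hS in
lemma ricci_φ_sq {n : ℕ} (hE : Module.finrank ℝ E = 2 * n + 1) :
    ricci nabla p y (S.φ p (S.φ p z)) = ricci nabla p y z + 2 * n * S.η p y * S.η p z := by
  rw [S.φ_sq, sub_eq_add_neg, ← neg_smul, ricci_add_right hn.smooth hn.torsion_free,
    ricci_smul_right hn.smooth hn.torsion_free, ricci_ξ hn hS p y hE]
  ring

-- ξ preserves the Ricci tensor even though it does not preserve the curvature, because the defect
-- of L_ξ R is trace-free.
open FieldCalculus in
include hn hS in
lemma act_ξ_ricciFun (Y Z : SmoothField E M) :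
    (fieldCalculus E M).act S.ξₛ (ricciFun hn.smooth hn.torsion_free Y Z)
      = ricciFun hn.smooth hn.torsion_free ((fieldCalculus E M).br S.ξₛ Y) Z
        + ricciFun hn.smooth hn.torsion_free Y ((fieldCalculus E M).br S.ξₛ Z) := by
  ext p
  obtain ⟨F⟩ := exists_frameAt (E := E) p
  let C := fieldCalculus E M
  let D : C.Connection := connection hn.smooth hn.torsion_free
  -- The defect terms of `lie_ξ_curv`, as an endomorphism in the first curvature slot.
  let Q : SmoothField E M →ₗ[SmoothFun E M] SmoothField E M :=
    (S.gₗ (S.φₗ Z)).smulRight ((2 * S.ηₗ Y) • S.ξₛ) - S.ηₗ.smulRight ((2 * S.gₗ Y (S.φₗ Z)) • S.ξₛ)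
      - (2 * (S.gₗ Y Z - S.ηₗ Y * S.ηₗ Z)) • S.φₗ
      + (S.gₗ Z).smulRight ((2 : SmoothFun E M) • S.φₗ Y) - S.ηₗ.smulRight ((2 * S.ηₗ Z) • S.φₗ Y)
  let R (Y Z : SmoothField E M) : SmoothField E M →ₗ[SmoothFun E M] SmoothField E M :=
    (D.curvₗ.flip Y).flip Z
  have hR (X Y Z : SmoothField E M) : R Y Z X = D.curv X Y Z := rfl
  have hT (X : SmoothField E M) : C.br S.ξₛ (R Y Z X)
      = R Y Z (C.br S.ξₛ X) + (R (C.br S.ξₛ Y) Z + R Y (C.br S.ξₛ Z) + Q) X := by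
    have h : C.br S.ξₛ (D.curv X Y Z) = D.curv (C.br S.ξₛ X) Y Z + D.curv X (C.br S.ξₛ Y) Z
        + D.curv X Y (C.br S.ξₛ Z)
        - (2 * (S.ηₗ X * S.gₗ Y (S.φₗ Z) - S.ηₗ Y * S.gₗ X (S.φₗ Z))) • S.ξₛ
        - (2 * (S.gₗ Y Z - S.ηₗ Y * S.ηₗ Z)) • S.φₗ X
        + (2 * (S.gₗ X Z - S.ηₗ X * S.ηₗ Z)) • S.φₗ Y := (toParaSasaki hn hS).lie_ξ_curv X Y Z
    have gs : ∀ X Y, S.gₗ X Y = S.gₗ Y X := (toParaSasaki hn hS).metric.symm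
    simp only [hR, LinearMap.add_apply, Q, LinearMap.sub_apply, LinearMap.smulRight_apply,
      LinearMap.smul_apply, gs _ X, h]
    module
  have key := congrArg (fun f : SmoothFun E M ↦ f p) (C.lie_trace F.smul_eq_sum S.ξₛ hT)
  -- χ is identically 1 near p, so the cutoff term of `lie_trace` drops out.
  have e1 : C.act S.ξₛ F.χ p = 0 := by
    rw [fieldCalculus_act, mvfderiv_congr (h := fun _ ↦ 1) F.χ_one, mvfderiv_const]
    rfl
  have e2 : C.act S.ξₛ (ricciFun hn.smooth hn.torsion_free Y Z) p
      = C.act S.ξₛ (∑ i, F.form i (R Y Z (F.e i))) p := by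
    rw [fieldCalculus_act, fieldCalculus_act]
    congr 1
    refine mvfderiv_congr ?_
    filter_upwards [F.χ_one] with q hq
    exact ricci_eq_frame hn.smooth hn.torsion_free F hq Y Z
  have e3 : (∑ i, F.form i (Q (F.e i))) p = 0 := by
    let q : TangentSpace 𝓘(ℝ, E) p →ₗ[ℝ] TangentSpace 𝓘(ℝ, E) p :=
      (S.bilin p (S.φ p (Z p))).smulRight ((2 * S.η p (Y p)) • S.ξ p)
        - (S.η p).toLinearMap.smulRight ((2 * S.metric p (Y p) (S.φ p (Z p))) • S.ξ p)
        - (2 * (S.metric p (Y p) (Z p) - S.η p (Y p) * S.η p (Z p))) • (S.φ p).toLinearMap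
        + (S.bilin p (Z p)).smulRight ((2 : ℝ) • S.φ p (Y p))
        - (S.η p).toLinearMap.smulRight ((2 * S.η p (Z p)) • S.φ p (Y p))
    have hq (X : SmoothField E M) : Q X p = q (X p) := by
      simp only [Q, LinearMap.add_apply, LinearMap.sub_apply, LinearMap.smulRight_apply,
        LinearMap.smul_apply, SmoothField.add_apply, SmoothField.smul_apply, SmoothField.sub_apply,
        SmoothFun.two_mul_apply, SmoothFun.two_apply]
      rfl
    rw [SmoothFun.sum_apply]
    simp only [F.form_apply, hq]
    rw [← F.trace_eq F.χ_self]
    simp only [q, map_sub, map_add, map_smul, LinearMap.trace_smulRight, S.trace_φ,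
      bilin_apply, ContinuousLinearMap.coe_coe, S.η_φ, S.η_ξ, S.metric_ξ, smul_eq_mul]
    rw [S.metric_symm p (Z p), S.metric_φ]
    ring
  have e4 := ricci_eq_frame hn.smooth hn.torsion_free F F.χ_self (C.br S.ξₛ Y) Z
  have e5 := ricci_eq_frame hn.smooth hn.torsion_free F F.χ_self Y (C.br S.ξₛ Z)
  have e6 : ∑ i, F.form i ((R (C.br S.ξₛ Y) Z + R Y (C.br S.ξₛ Z) + Q) (F.e i))
      = ∑ i, F.form i (D.curv (F.e i) (C.br S.ξₛ Y) Z)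
        + ∑ i, F.form i (D.curv (F.e i) Y (C.br S.ξₛ Z)) + ∑ i, F.form i (Q (F.e i)) := by
    simp only [LinearMap.add_apply, map_add, Finset.sum_add_distrib, hR]
  rw [e6] at key
  change F.χ p * C.act S.ξₛ (∑ i, F.form i (R Y Z (F.e i))) p
    = C.act S.ξₛ F.χ p * _ + F.χ p * ((∑ i, F.form i (D.curv (F.e i) (C.br S.ξₛ Y) Z)) p
      + (∑ i, F.form i (D.curv (F.e i) Y (C.br S.ξₛ Z))) p
      + (∑ i, F.form i (Q (F.e i))) p) at key
  rw [e1, e3, F.χ_self, ← e2, ← e4, ← e5, zero_mul, zero_add, one_mul, one_mul, add_zero] at key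
  exact key

end Ricci

end RiemannianPiStructure

/-- A constant function. -/
abbrev SmoothFun.const (a : ℝ) : SmoothFun E M := ContMDiffMap.const a

lemma act_const (X : SmoothField E M) (a : ℝ) :
    (fieldCalculus E M).act X (SmoothFun.const a) = 0 := by
  ext p
  exact congrArg (fun L ↦ L (X p)) (mvfderiv_const (I := 𝓘(ℝ, E)) a (x := p))

/-! ### The manifold as a model of the algebraic soliton, and the Ricci tensor of the associated
metric. -/

namespace RiemannianPiStructure

variable {S : RiemannianPiStructure E M}
  {nabla nabla' : CovariantDerivative 𝓘(ℝ, E) E (fun p : M ↦ TangentSpace 𝓘(ℝ, E) p)}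
  (hn : IsLeviCivita S.metric nabla) (hn' : IsLeviCivita S.assocMetric nabla')
  (hS : S.IsParaSasakiLike nabla)

lemma toSoliton {n : ℕ} (hE : Module.finrank ℝ E = 2 * n + 1) (v : SmoothField E M)
    {lam mu nu : ℝ} (hsol : S.IsParaRicciLikeSoliton nabla v lam mu nu) :
    (toParaSasaki hn hS).Soliton v (fun X Y ↦ ricciFun hn.smooth hn.torsion_free X Y)
      (.const lam) (.const mu) (.const nu) (.const (2 * n)) where
  act_lam X := act_const X _
  act_mu X := act_const X _
  act_nu X := act_const X _
  act_N X := act_const X _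
  ρ_ξ X := by ext p; exact ricci_ξ hn hS p (X p) hE
  ρ_φφ X Y := by
    ext p
    refine (ricci_φ_comm hn hS p (X p) (S.φ p (Y p)) hE).symm.trans ?_
    exact ricci_φ_sq hn hS p (X p) (Y p) hE
  ρ_φ_sq X Y := by ext p; exact ricci_φ_sq hn hS p (X p) (Y p) hE
  ρ_lie X Y := act_ξ_ricciFun hn hS X Y
  eqn X Y := by
    ext p
    have h := hsol X Y X.isSmoothField Y.isSmoothField p
    rw [lieDeriv] at h
    rw [mul_assoc 2, mul_assoc 2, mul_assoc 2]
    simp only [ContMDiffMap.coe_sub, ContMDiffMap.coe_add, Pi.sub_apply, Pi.add_apply,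
      SmoothFun.two_mul_apply]
    change mvfderiv 𝓘(ℝ, E) (fun q ↦ S.metric q (X q) (Y q)) p (v p)
      = S.metric p (VectorField.mlieBracket 𝓘(ℝ, E) v X p) (Y p)
        + S.metric p (X p) (VectorField.mlieBracket 𝓘(ℝ, E) v Y p)
        - 2 * ricci nabla p (X p) (Y p) - 2 * (lam * S.metric p (X p) (Y p))
        - 2 * (mu * S.assocMetric p (X p) (Y p)) - 2 * (nu * (S.η p (X p) * S.η p (Y p)))
    linear_combination (2 : ℝ) * h

/-- The associated metric on smooth vector fields. -/
def assocₗ (S : RiemannianPiStructure E M) :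
    SmoothField E M →ₗ[SmoothFun E M] SmoothField E M →ₗ[SmoothFun E M] SmoothFun E M :=
  S.gₗ.compl₂ S.φₗ + S.ηₗ.smulRight S.ηₗ

lemma assocMetric_symm (p : M) (x y : TangentSpace 𝓘(ℝ, E) p) :
    S.assocMetric p x y = S.assocMetric p y x := by
  rw [assocMetric, assocMetric, ← S.metric_φ, S.metric_symm, mul_comm]

include hn' in
lemma isMetric_assocₗ : (connection hn'.smooth hn'.torsion_free).IsMetric S.assocₗ where
  symm X Y := by ext p; exact assocMetric_symm p (X p) (Y p)
  compat X Y Z := by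
    ext p
    exact hn'.metric p Y Z (Y.mdiffAt p) (Z.mdiffAt p) (X p)

include hn hn' hS in
/-- The two Levi-Civita connections have the same Ricci tensor. -/
lemma ricci_assoc (p : M) (y z : TangentSpace 𝓘(ℝ, E) p) :
    ricci nabla' p y z = ricci nabla p y z := by
  have h : curvatureEnd hn'.smooth hn'.torsion_free p y z
      = curvatureEnd hn.smooth hn.torsion_free p y z
        + (S.bilin p (S.φ p z)).smulRight (S.η p y • S.ξ p)
        - (S.bilin p z).smulRight (S.η p y • S.ξ p)
        + (S.η p).toLinearMap.smulRight ((S.metric p y z - S.metric p y (S.φ p z)) • S.ξ p)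
        + (S.metric p y (S.φ p z) - S.metric p y z + S.η p y * S.η p z) • (S.φ p).toLinearMap
        - (S.bilin p (S.φ p z)).smulRight (S.φ p y) + (S.bilin p z).smulRight (S.φ p y)
        - (S.η p).toLinearMap.smulRight (S.η p z • S.φ p y) := by
    ext x
    obtain ⟨X, rfl, -⟩ := exists_smoothField p x
    obtain ⟨Y, rfl, -⟩ := exists_smoothField p y
    obtain ⟨Z, rfl, -⟩ := exists_smoothField p z
    have e := congrArg (fun W : SmoothField E M ↦ W p) ((toParaSasaki hn hS).curv_associated
      (fun _ _ ↦ rfl) (isMetric_assocₗ hn') X Y Z)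
    simp only [SmoothField.add_apply, SmoothField.smul_apply, SmoothField.sub_apply] at e
    simp only [LinearMap.sub_apply, LinearMap.add_apply, LinearMap.smul_apply,
      LinearMap.smulRight_apply, curvatureEnd_apply, bilin_apply, ContinuousLinearMap.coe_coe,
      S.metric_symm p _ (X p)]
    rw [curvatureAt_eq hn.smooth hn.torsion_free, curvatureAt_eq hn'.smooth hn'.torsion_free, e]
    change _ + (S.η p (Y p) * S.metric p (X p) (S.φ p (Z p))
        - S.η p (X p) * S.metric p (Y p) (S.φ p (Z p))
        - S.η p (Y p) * S.metric p (X p) (Z p) + S.η p (X p) * S.metric p (Y p) (Z p)) • S.ξ p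
      + (S.metric p (Y p) (S.φ p (Z p)) - S.metric p (Y p) (Z p)
        + S.η p (Y p) * S.η p (Z p)) • S.φ p (X p)
      - (S.metric p (X p) (S.φ p (Z p)) - S.metric p (X p) (Z p)
        + S.η p (X p) * S.η p (Z p)) • S.φ p (Y p) = _
    module
  -- The difference of the curvatures is a sum of multiples of φ and rank-one maps whose traces
  -- cancel.
  rw [ricci_eq_trace hn.smooth hn.torsion_free, ricci_eq_trace hn'.smooth hn'.torsion_free, h]
  simp only [map_sub, map_add, map_smul, LinearMap.trace_smulRight, S.trace_φ,
    bilin_apply, ContinuousLinearMap.coe_coe, S.η_φ, S.η_ξ, S.metric_ξ, smul_eq_mul]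
  have e : S.metric p (S.φ p z) (S.φ p y) = S.metric p z y - S.η p z * S.η p y := S.g_φ p z y
  rw [e, S.metric_symm p z, S.metric_symm p z, S.metric_φ]
  ring

end RiemannianPiStructure

/-! ### Conclusions at a point: the Ricci tensor of the soliton and the scalar curvatures. -/

namespace RiemannianPiStructure

variable {S : RiemannianPiStructure E M}
  {nabla nabla' : CovariantDerivative 𝓘(ℝ, E) E (fun p : M ↦ TangentSpace 𝓘(ℝ, E) p)}

lemma φ_cube (p : M) (x : TangentSpace 𝓘(ℝ, E) p) : S.φ p (S.φ p (S.φ p x)) = S.φ p x := by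
  rw [S.φ_sq, S.η_φ, zero_smul, sub_zero]

lemma trace_φ_comp {n : ℕ} (hE : Module.finrank ℝ E = 2 * n + 1) (p : M) :
    LinearMap.trace ℝ _ ((S.φ p).toLinearMap ∘ₗ (S.φ p).toLinearMap) = 2 * n := by
  have h : (S.φ p).toLinearMap ∘ₗ (S.φ p).toLinearMap
      = LinearMap.id - (S.η p).toLinearMap.smulRight (S.ξ p) := by
    ext x
    exact S.φ_sq p x
  rw [h, map_sub, LinearMap.trace_id, LinearMap.trace_smulRight, finrank_tangentSpace, hE]
  change _ - S.η p (S.ξ p) = _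
  rw [S.η_ξ]
  push_cast
  ring

lemma exists_φ_sq_ne_zero {n : ℕ} (hE : Module.finrank ℝ E = 2 * n + 1) (h0 : n ≠ 0) (p : M) :
    ∃ x, S.φ p (S.φ p x) ≠ 0 := by
  by_contra! h
  have h1 := S.trace_φ_comp hE p
  rw [show (S.φ p).toLinearMap ∘ₗ (S.φ p).toLinearMap = 0 from LinearMap.ext h, map_zero] at h1
  exact h0 (by exact_mod_cast (mul_eq_zero.1 h1.symm).resolve_left two_ne_zero)

section Soliton

variable (hn : IsLeviCivita S.metric nabla) (hS : S.IsParaSasakiLike nabla)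
  {n : ℕ} (hE : Module.finrank ℝ E = 2 * n + 1) (v : SmoothField E M)
  {lam mu nu : ℝ} (hsol : S.IsParaRicciLikeSoliton nabla v lam mu nu)

include hn hS hE hsol

lemma soliton_const (h0 : n ≠ 0) : (.const (2 * n) - .const lam - .const mu - .const nu :
    SmoothFun E M) = 0 := by
  have H := toSoliton hn hS hE v hsol
  ext p
  obtain ⟨x, hx⟩ := S.exists_φ_sq_ne_zero hE h0 p
  obtain ⟨X, rfl, -⟩ := exists_smoothField p x
  set c : SmoothFun E M := .const (2 * n) - .const lam - .const mu - .const nu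
  have h : (4 * c) • S.φₗ (S.φₗ X) = 0 := H.const_smul_φ_sq X
  rw [show 4 * c = 2 * (2 * c) by ring] at h
  have h1 := congrArg (fun W : SmoothField E M ↦ W p) h
  rw [SmoothField.smul_apply, SmoothFun.two_mul_apply, SmoothFun.two_mul_apply] at h1
  have h2 := (smul_eq_zero.1 h1).resolve_right hx
  change c p = 0
  linarith

lemma soliton_grad (h0 : n ≠ 0) : (toParaSasaki hn hS).grad v 0 = 0 := by
  have H := toSoliton hn hS hE v hsol
  have hc := soliton_const hn hS hE v hsol h0
  set G := (toParaSasaki hn hS).grad v 0 with hG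
  have hη : S.ηₗ G = 0 := by
    have := H.η_grad
    rw [hc] at this
    exact this
  ext p
  have key (z : TangentSpace 𝓘(ℝ, E) p) : S.metric p (S.φ p z) (G p) = 0 := by
    set a := S.metric p (S.φ p (S.φ p z)) (G p)
    set b := S.metric p (S.φ p z) (G p) with hb
    -- `grad_φ` is evaluated on φx, φy and φ²z, all horizontal, so that it becomes an identity
    -- between endomorphisms of the whole tangent space. Its trace reads 2n b = 0.
    have e (x : TangentSpace 𝓘(ℝ, E) p) : b • S.φ p (S.φ p x) = a • S.φ p x := by
      rw [← sub_eq_zero]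
      refine S.eq_zero_of_metric p _ fun y ↦ ?_
      obtain ⟨X, rfl, -⟩ := exists_smoothField p x
      obtain ⟨Y, rfl, -⟩ := exists_smoothField p y
      obtain ⟨Z, rfl, -⟩ := exists_smoothField p z
      have h1 := H.grad_φ hc ((toParaSasaki hn hS).η_φ X) ((toParaSasaki hn hS).η_φ Y)
        ((toParaSasaki hn hS).η_φ (S.φₗ Z))
      have h2 : S.metric p (S.φ p (S.φ p (S.φ p (Z p)))) (G p)
          * S.metric p (S.φ p (X p)) (S.φ p (Y p))
        = a * S.metric p (S.φ p (X p)) (S.φ p (S.φ p (Y p))) :=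
        congrArg (fun f : SmoothFun E M ↦ f p) h1
      rw [φ_cube, ← hb, ← S.metric_φ, ← S.metric_φ, ← S.metric_φ, φ_cube] at h2
      change S.bilin p _ _ = 0
      rw [map_sub, map_smul, map_smul]
      exact sub_eq_zero.2 h2
    have h3 : b • ((S.φ p).toLinearMap ∘ₗ (S.φ p).toLinearMap) = a • (S.φ p).toLinearMap :=
      LinearMap.ext e
    have h4 := congrArg (LinearMap.trace ℝ _) h3
    rw [map_smul, map_smul, S.trace_φ, S.trace_φ_comp hE, smul_zero, smul_eq_mul] at h4
    exact (mul_eq_zero.1 h4).resolve_right (by positivity)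
  have hφ : S.φ p (G p) = 0 := S.eq_zero_of_metric p _ fun z ↦ by
    rw [S.metric_symm, ← S.metric_φ, key]
  have h5 := S.φ_sq p (G p)
  have h6 : S.η p (G p) = 0 := congrArg (fun f : SmoothFun E M ↦ f p) hη
  rw [hφ, map_zero, h6, zero_smul, sub_zero] at h5
  exact h5.symm

/-- The Ricci tensor of a para-Ricci-like soliton. -/
lemma ricci_eq (p : M) (x y : TangentSpace 𝓘(ℝ, E) p) :
    ricci nabla p x y = -(2 * n : ℝ) * (S.η p x * S.η p y) := by
  obtain rfl | h0 := eq_or_ne n 0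
  -- In dimension one φ² = 0, so c need not vanish; but ξ spans the tangent space and `ricci_ξ`
  -- suffices.
  · have hξ : S.ξ p ≠ 0 := fun h ↦ by simpa [h] using S.η_ξ p
    obtain ⟨c, rfl⟩ := exists_smul_eq_of_finrank_eq_one
      (show Module.finrank ℝ (TangentSpace 𝓘(ℝ, E) p) = 1 from hE) hξ y
    rw [ricci_smul_right hn.smooth hn.torsion_free, ricci_ξ hn hS p x hE]
    simp
  · obtain ⟨X, rfl, -⟩ := exists_smoothField p x
    obtain ⟨Y, rfl, -⟩ := exists_smoothField p y
    have h := (toSoliton hn hS hE v hsol).hess_φ X Y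
    rw [soliton_const hn hS hE v hsol h0, soliton_grad hn hS hE v hsol h0] at h
    simp only [map_zero, LinearMap.zero_apply, mul_zero, zero_mul, sub_zero, add_zero, neg_zero]
      at h
    set r := ricciFun hn.smooth hn.torsion_free X Y
    have h1 : 2 * (2 * (r + .const (2 * n) * (S.ηₗ X * S.ηₗ Y))) = 0 := by
      refine Eq.trans ?_ h
      change _ = 4 * r + 4 * .const (2 * n) * S.ηₗ X * S.ηₗ Y
      ring
    have h2 := congrArg (fun f : SmoothFun E M ↦ f p) h1
    simp only [SmoothFun.two_mul_apply] at h2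
    change 2 * (2 * (ricci nabla p (X p) (Y p) + 2 * n * (S.η p (X p) * S.η p (Y p)))) = 0 at h2
    linear_combination h2 / 4

/-- With grad η(v) = 0 and c = 0 one has [v, ξ] = 0, and closedness of η gives L_v η = 0. For n = 0
the factor 2n kills every term. -/
lemma lieDeriv_ricci_ξ (X : SmoothField E M) (p : M) :
    lieDeriv v (ricci nabla) X S.ξ p = 0 := by
  have hr : ricciFun hn.smooth hn.torsion_free X S.ξₛ = .const (-(2 * n)) * S.ηₗ X := by
    ext q
    exact ricci_ξ hn hS q (X q) hE
  have h1 : lieDeriv v (ricci nabla) X S.ξ p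
      = (fieldCalculus E M).act v (ricciFun hn.smooth hn.torsion_free X S.ξₛ) p
        - ricci nabla p ((fieldCalculus E M).br v X p) (S.ξ p)
        - ricci nabla p (X p) ((fieldCalculus E M).br v S.ξₛ p) := rfl
  have h2 : (fieldCalculus E M).act v (ricciFun hn.smooth hn.torsion_free X S.ξₛ) p
      = -(2 * n : ℝ) * (fieldCalculus E M).act v (S.ηₗ X) p := by
    rw [hr, (fieldCalculus E M).act_mul, act_const, zero_mul, zero_add]
    rfl
  rw [h1, h2, ricci_eq hn hS hE v hsol, ricci_eq hn hS hE v hsol, S.η_ξ]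
  obtain rfl | h0 := eq_or_ne n 0
  · simp
  have H := toSoliton hn hS hE v hsol
  have hc := soliton_const hn hS hE v hsol h0
  have hG := soliton_grad hn hS hE v hsol h0
  have h3 : (fieldCalculus E M).br v S.ξₛ = 0 := by
    refine ((toParaSasaki hn hS).br_eq_grad v 0).trans ?_
    rw [hG, mul_zero, zero_smul, sub_zero]
  have h4 := H.g_grad X
  rw [hc, hG, map_zero] at h4
  have h5 := (toParaSasaki hn hS).dη v X
  rw [← h4, sub_zero] at h5
  have h6 : (fieldCalculus E M).act v (S.ηₗ X) p = S.η p ((fieldCalculus E M).br v X p) :=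
    congrArg (fun f : SmoothFun E M ↦ f p) h5
  rw [h6, h3, SmoothField.zero_apply, map_zero]
  ring

end Soliton

section ScalarCurvature

/-- Raising the index of η gives ξ, so the contraction of η ⊗ η is η(ξ) = 1. Only nondegeneracy of
the form is used, not its sign, so that g and the associated metric are both covered. -/
lemma scalarCurvature_eq {p : M} {h : Π p : M, TangentSpace 𝓘(ℝ, E) p → TangentSpace 𝓘(ℝ, E) p → ℝ}
    (B : TangentSpace 𝓘(ℝ, E) p →ₗ[ℝ] TangentSpace 𝓘(ℝ, E) p →ₗ[ℝ] ℝ)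
    (hB : ∀ x y, h p x y = B x y) (hξ : ∀ x, B x (S.ξ p) = S.η p x)
    (hnd : ∀ y, (∀ x, B x y = 0) → y = 0) {a : ℝ}
    (hr : ∀ x y, ricci nabla p x y = a * (S.η p x * S.η p y)) :
    scalarCurvature h nabla p = a := by
  set b := tangentBasis (E := E) p
  set G : Matrix _ _ ℝ := Matrix.of fun k l ↦ h p (b k) (b l) with hG
  have mulVec (c : Fin (Module.finrank ℝ E) → ℝ) : G.mulVec c = fun k ↦ B (b k) (∑ l, c l • b l) := by
    ext k
    simp [Matrix.mulVec, dotProduct, hG, hB, mul_comm]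
  have hdet : IsUnit G.det := by
    rw [isUnit_iff_ne_zero]
    intro h0
    obtain ⟨c, hc, h1⟩ := Matrix.exists_mulVec_eq_zero_iff.2 h0
    rw [mulVec] at h1
    have h2 : ∑ l, c l • b l = 0 := hnd _ fun x ↦ by
      rw [← b.sum_repr x, map_sum B, LinearMap.sum_apply]
      refine Finset.sum_eq_zero fun k _ ↦ ?_
      rw [map_smul, LinearMap.smul_apply, congrFun h1 k, Pi.zero_apply, smul_zero]
    exact hc (funext fun l ↦ Fintype.linearIndependent_iff.1 b.linearIndependent c h2 l)
  have h1 : G.mulVec (fun l ↦ b.repr (S.ξ p) l) = fun k ↦ S.η p (b k) := by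
    rw [mulVec, b.sum_repr]
    exact funext fun k ↦ hξ _
  have h2 : G⁻¹.mulVec (fun k ↦ S.η p (b k)) = fun l ↦ b.repr (S.ξ p) l := by
    rw [← h1, Matrix.mulVec_mulVec, Matrix.nonsing_inv_mul _ hdet, Matrix.one_mulVec]
  have h3 : ∑ i, S.η p (b i) * b.repr (S.ξ p) i = 1 := by
    rw [← S.η_ξ p]
    conv_rhs => rw [← b.sum_repr (S.ξ p), map_sum]
    exact Finset.sum_congr rfl fun i _ ↦ by rw [map_smul, smul_eq_mul, mul_comm]
  calc scalarCurvature h nabla p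
      = ∑ i, a * (S.η p (b i) * G⁻¹.mulVec (fun k ↦ S.η p (b k)) i) := by
        refine Finset.sum_congr rfl fun i _ ↦ ?_
        simp only [Matrix.mulVec, dotProduct, Finset.mul_sum]
        refine Finset.sum_congr rfl fun j _ ↦ ?_
        rw [hr]; ring
    _ = a := by rw [h2, ← Finset.mul_sum, h3, mul_one]

variable (S) in
/-- The associated metric at a point as a bilinear form. -/
def assocBilin (p : M) :
    TangentSpace 𝓘(ℝ, E) p →ₗ[ℝ] TangentSpace 𝓘(ℝ, E) p →ₗ[ℝ] ℝ :=
  (S.bilin p).compl₂ (S.φ p).toLinearMap + (S.η p).toLinearMap.smulRight (S.η p).toLinearMap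

lemma assocBilin_apply (p : M) (x y : TangentSpace 𝓘(ℝ, E) p) :
    S.assocBilin p x y = S.assocMetric p x y := rfl

lemma eq_zero_of_assocMetric (p : M) (y : TangentSpace 𝓘(ℝ, E) p)
    (h : ∀ x, S.assocMetric p x y = 0) : y = 0 := by
  have h1 : S.φ p y + S.η p y • S.ξ p = 0 := S.eq_zero_of_metric p _ fun x ↦ by
    rw [S.metric_symm]
    change S.bilin p x _ = 0
    rw [map_add, map_smul, S.bilin_apply, S.bilin_apply, S.metric_ξ, smul_eq_mul, mul_comm]
    exact h x
  have h2 : S.η p y = 0 := by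
    have := congrArg (S.η p) h1
    rwa [map_add, map_smul, S.η_φ, S.η_ξ, smul_eq_mul, mul_one, zero_add, map_zero] at this
  have h3 : S.φ p y = 0 := by rwa [h2, zero_smul, add_zero] at h1
  have h4 := S.φ_sq p y
  rw [h3, map_zero, h2, zero_smul, sub_zero] at h4
  exact h4.symm

end ScalarCurvature

end RiemannianPiStructure

end

end PiGeometry

theorem proposition3p2 (n : ℕ)
    {E : Type*} [NormedAddCommGroup E] [NormedSpace ℝ E] [FiniteDimensional ℝ E]
    (hE : Module.finrank ℝ E = 2 * n + 1)
    {M : Type*} [TopologicalSpace M] [T2Space M] [SecondCountableTopology M]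
    [ChartedSpace E M] [IsManifold 𝓘(ℝ, E) ∞ M]
    (S : PiGeometry.RiemannianPiStructure E M)
    -- the Levi-Civita connections of `g` and of the associated metric
    (nabla nabla' : CovariantDerivative 𝓘(ℝ, E) E (fun p : M ↦ TangentSpace 𝓘(ℝ, E) p))
    (hnabla : PiGeometry.IsLeviCivita S.metric nabla)
    (hnabla' : PiGeometry.IsLeviCivita S.assocMetric nabla')
    (hS : S.IsParaSasakiLike nabla)
    (v : Π p : M, TangentSpace 𝓘(ℝ, E) p) (hv : PiGeometry.IsSmoothField v)
    (lam mu nu : ℝ) (hsol : S.IsParaRicciLikeSoliton nabla v lam mu nu) :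
    (∀ X : Π p : M, TangentSpace 𝓘(ℝ, E) p, PiGeometry.IsSmoothField X →
      ∀ p : M, PiGeometry.lieDeriv v (PiGeometry.ricci nabla) X S.ξ p = 0) ∧
    (∀ p : M, PiGeometry.scalarCurvature S.metric nabla p = -2 * (n : ℝ)) ∧
    (∃ c : ℝ, ∀ p : M, PiGeometry.scalarCurvature S.assocMetric nabla' p = c) := by
  have hr := PiGeometry.RiemannianPiStructure.ricci_eq hnabla hS hE ⟨v, hv⟩ hsol
  -- The constant for the associated metric is again -2n, as the two metrics share the Ricci tensor
  -- and the dual pair ξ, η.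
  refine ⟨fun X hX p ↦ PiGeometry.RiemannianPiStructure.lieDeriv_ricci_ξ hnabla hS hE ⟨v, hv⟩ hsol
    ⟨X, hX⟩ p, fun p ↦ ?_, -2 * (n : ℝ), fun p ↦ ?_⟩
  · refine PiGeometry.RiemannianPiStructure.scalarCurvature_eq (S := S) (S.bilin p)
      (fun _ _ ↦ rfl) (S.metric_ξ p)
      (fun y h ↦ S.eq_zero_of_metric p y fun x ↦ (S.metric_symm p y x).trans (h x)) fun x y ↦ ?_
    rw [hr]
    ring
  · refine PiGeometry.RiemannianPiStructure.scalarCurvature_eq (S := S) (S.assocBilin p)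
      (fun _ _ ↦ rfl) (fun x ↦ ?_) (fun y h ↦ S.eq_zero_of_assocMetric p y h) fun x y ↦ ?_
    · rw [S.assocBilin_apply, PiGeometry.RiemannianPiStructure.assocMetric, S.φ_ξ, S.η_ξ, mul_one]
      exact (congrArg (· + S.η p x) (map_zero (S.bilin p x))).trans (zero_add _)
    · rw [PiGeometry.RiemannianPiStructure.ricci_assoc hnabla hnabla' hS, hr]
      ring
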